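/- **Conventions.** A category is *quasi-pointed* if it has an initial object $0$, a terminal object $1$, and $0\to 1$ is a monomorphism. In such a category a *kernel* $\ker f\colon K[f]\to A$ of $f\colon A\to B$ is a pullback of $0\to B$ along $f$, and a *cokernel* of $k\colon K\to A$ is a pushout of $K\to 0$ along $k$ (for $K$ admitting an arrow to $0$); a *short exact sequence* $0\to K\xrightarrow{k}A\xrightarrow{f}B\to 1$ is a pair with $k=\ker f$ and $f=\operatorname{coker}k$; if $k\colon K\to A$ is a kernel, $A/K$ denotes its cokernel object. A category is *sequentiable* if it is quasi-pointed, regular and (Bourn) protomodular, and *exact* if it is Barr exact. A sequence is *exact* at an object if the image of the incoming arrow is a kernel of the outgoing one; exactness of $\cdots\to X\xrightarrow{g}Y\to 1$ means exactness at all objects before $Y$ (in particular at $X$) and that $g$ is a regular epimorphism (exactness at $Y$ is not required). Projectives are taken relative to regular epimorphisms. Let $\mathcal A$ be an exact and sequentiable category with enough projectives. A *Birkhoff subfunctor* of $\mathcal A$ is a subfunctor $\mu\colon V\Rightarrow 1_{\mathcal A}$ all of whose components $\mu_A$ are kernels and such that $V$ preserves regular epimorphisms. Fix one, and put: * $U(A)$: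 the cokernel object of $\mu_A\colon V(A)\to A$, with $\eta_A=\operatorname{coker}\mu_A$; * for a regular epimorphism $p\colon A_0\to A$ with kernel pair $(R[p],k_0,k_1)$, $V_1p\to V(A_0)$: the kernel of the coequalizer of $Vk_0,Vk_1\colon V(R[p])\rightrightarrows V(A_0)$; * for a fixed choice of a projective presentation (a regular epimorphism $p\colon A_0\to A$ with $A_0$ projective) of every object $A$ and of a lift of every morphism to the chosen presentations, $$DV(A)=\frac{V(A_0)}{V_1p},\qquad \Delta V(A)=\frac{K[p]\cap V(A_0)}{V_1p},$$ which are functors $\mathcal A\to\mathcal A$; $\alpha_A\colon DV(A)\to A$ is the natural arrow induced by $p\circ\mu_{A_0}$; * for a short exact sequence $0\to K\xrightarrow{k} A\xrightarrow{f} B\to 1$, $\gamma\colon K[DVf]\to K$: the arrow with $k\circ\gamma=\alpha_A\circ\ker(DVf)$. The arrow $\mu_A$ restricts to an inclusion $V_1f\to K$. **Theorem.** For every short exact sequence $0\to K\xrightarrow{k}A\xrightarrow{f}B\to 1$ in $\mathcal A$, the inclusion $V_1f\to K$ is a kernel and has a cokernel $K\to K/V_1f$, and there is an exact sequence $$0\to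 K[\gamma]\to\Delta V(A)\xrightarrow{\Delta Vf}\Delta V(B)\to\frac{K}{V_1f}\to U(A)\xrightarrow{Uf}U(B)\to 1,$$ which depends naturally on the given short exact sequence. Here $K[\gamma]\to\Delta V(A)$ is the arrow whose composite with the canonical $\Delta V(A)\to DV(A)$ is $\ker(DVf)\circ\ker\gamma$, and $K/V_1f\to U(A)$ is induced by $\eta_A\circ k$. -/

import Mathlib

open CategoryTheory CategoryTheory.Limits

universe v u

namespace Baer

noncomputable section

/-! ### The categorical context -/

section Context

variable (C : Type u) [Category.{v} C]

/-- A category is quasi-pointed when it has an initial object `0` and a terminal object `1`, and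
the arrow `0 ⟶ 1` is a monomorphism. -/
class QuasiPointed : Prop extends HasInitial C, HasTerminal C where
  mono_initial_to_terminal : Mono (initial.to (⊤_ C))

/-- Bourn protomodularity: in a commutative diagram of two adjacent squares whose middle vertical
arrow is a split epimorphism, if the left-hand square and the outer rectangle are pullbacks,
then so is the right-hand square. -/
class Protomodular : Prop where
  isPullback_right : ∀ {X₁ X₂ X₃ Y₁ Y₂ Y₃ : C} {a : X₁ ⟶ X₂} {b : X₂ ⟶ X₃}
    {v₁ : X₁ ⟶ Y₁} {v₂ : X₂ ⟶ Y₂} {v₃ : X₃ ⟶ Y₃} {a' : Y₁ ⟶ Y₂} {b' : Y₂ ⟶ Y₃},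
    IsSplitEpi v₂ → b ≫ v₃ = v₂ ≫ b' → IsPullback a v₁ v₂ a' →
    IsPullback (a ≫ b) v₁ v₃ (a' ≫ b') → IsPullback b v₂ v₃ b'

/-- A Barr exact category: a regular category in which every internal equivalence relation is a
kernel pair. -/
class BarrExact : Prop extends Regular C where
  exists_isKernelPair : ∀ {R A : C} (r₀ r₁ : R ⟶ A), IsEquivalenceRelation r₀ r₁ →
    ∃ (B : C) (f : A ⟶ B), IsKernelPair f r₀ r₁

/-- A sequentiable category: quasi-pointed, regular and protomodular. -/
class Sequentiable : Prop extends QuasiPointed C, Regular C, Protomodular C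

variable {C} in
/-- Projectivity with respect to regular epimorphisms. -/
def IsRegularProjective (P : C) : Prop :=
  ∀ {E B : C} (e : E ⟶ B), IsRegularEpi e → ∀ f : P ⟶ B, ∃ g : P ⟶ E, g ≫ e = f

/-- Every object is a regular quotient of a regular projective object. -/
class EnoughRegularProjectives : Prop where
  exists_presentation : ∀ A : C, ∃ (P : C) (p : P ⟶ A), IsRegularProjective P ∧ IsRegularEpi p

end Context

variable {C : Type u} [Category.{v} C]

/-! ### Zero morphisms, kernels, cokernels, exactness -/

section Kernels

/-- A zero morphism is a morphism that factors over the initial object. -/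
def IsZeroHom [HasInitial C] {A B : C} (f : A ⟶ B) : Prop :=
  ∃ t : A ⟶ ⊥_ C, f = t ≫ initial.to B

/-- `k` is a kernel of `f`: it is a pullback of `0 ⟶ B` along `f`. -/
def IsKer [HasInitial C] {K A B : C} (k : K ⟶ A) (f : A ⟶ B) : Prop :=
  ∃ t : K ⟶ ⊥_ C, IsPullback k t f (initial.to B)

/-- `q` is a cokernel of `k`: it is a pushout of `K ⟶ 0` along `k`. -/
def IsCoker [HasInitial C] {K A Q : C} (q : A ⟶ Q) (k : K ⟶ A) : Prop :=
  ∃ t : K ⟶ ⊥_ C, IsPushout k t q (initial.to Q)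

/-- `k` is a kernel of some morphism. -/
def IsNormal [HasInitial C] {K A : C} (k : K ⟶ A) : Prop :=
  ∃ (B : C) (f : A ⟶ B), IsKer k f

/-- `K ⟶ A ⟶ B` is a short exact sequence: `k = ker f` and `f = coker k`. -/
def IsShortExact [HasInitial C] {K A B : C} (k : K ⟶ A) (f : A ⟶ B) : Prop :=
  IsKer k f ∧ IsCoker f k

/-- `X ⟶ A ⟶ Y` is exact at `A`: the image of `f` (the monic part of its factorization as a
regular epimorphism followed by a monomorphism) is a kernel of `g`. -/
def ExactAt [HasInitial C] {X A Y : C} (f : X ⟶ A) (g : A ⟶ Y) : Prop :=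
  ∃ (I : C) (e : X ⟶ I) (m : I ⟶ A), IsRegularEpi e ∧ e ≫ m = f ∧ IsKer m g

lemma hom_initial_eq [QuasiPointed C] {X : C} (s t : X ⟶ ⊥_ C) : s = t := by
  have : Mono (initial.to (⊤_ C)) := QuasiPointed.mono_initial_to_terminal
  rw [← cancel_mono (initial.to (⊤_ C))]
  exact Subsingleton.elim _ _

lemma mono_initial_to [QuasiPointed C] (X : C) : Mono (initial.to X) :=
  ⟨fun _ _ _ => hom_initial_eq _ _⟩

lemma IsZeroHom.eq [QuasiPointed C] {A B : C} {f g : A ⟶ B} (hf : IsZeroHom f)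
    (hg : IsZeroHom g) : f = g := by
  obtain ⟨s, rfl⟩ := hf
  obtain ⟨t, rfl⟩ := hg
  rw [hom_initial_eq s t]

lemma IsZeroHom.comp_right [HasInitial C] {A B D : C} {f : A ⟶ B} (hf : IsZeroHom f)
    (g : B ⟶ D) : IsZeroHom (f ≫ g) := by
  obtain ⟨t, rfl⟩ := hf
  exact ⟨t, by simp⟩

lemma IsZeroHom.comp_left [HasInitial C] {A B D : C} {f : A ⟶ B} (hf : IsZeroHom f)
    (g : D ⟶ A) : IsZeroHom (g ≫ f) := by
  obtain ⟨t, rfl⟩ := hf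
  exact ⟨g ≫ t, by simp⟩

lemma IsZeroHom.of_comp_mono [QuasiPointed C] {A B D : C} {f : A ⟶ B} (g : B ⟶ D) [Mono g]
    (h : IsZeroHom (f ≫ g)) : IsZeroHom f := by
  obtain ⟨t, ht⟩ := h
  exact ⟨t, by rw [← cancel_mono g, ht]; simp⟩

section IsKer

variable [QuasiPointed C] {K A B : C} {k : K ⟶ A} {f : A ⟶ B}

lemma IsKer.mono (h : IsKer k f) : Mono k := by
  obtain ⟨t, ht⟩ := h
  exact ⟨fun x y hxy => ht.hom_ext hxy (hom_initial_eq _ _)⟩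

lemma IsKer.zero (h : IsKer k f) : IsZeroHom (k ≫ f) := by
  obtain ⟨t, ht⟩ := h
  exact ⟨t, ht.w⟩

lemma IsKer.exists_lift (h : IsKer k f) {T : C} (x : T ⟶ A) (hx : IsZeroHom (x ≫ f)) :
    ∃ y : T ⟶ K, y ≫ k = x := by
  obtain ⟨t, ht⟩ := h
  obtain ⟨s, hs⟩ := hx
  exact ⟨ht.lift x s hs, ht.lift_fst _ _ _⟩

/-- The factorization of a morphism that is killed by `f` through a kernel of `f`. -/
def IsKer.lift (h : IsKer k f) {T : C} (x : T ⟶ A) (hx : IsZeroHom (x ≫ f)) : T ⟶ K :=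
  (h.exists_lift x hx).choose

@[simp]
lemma IsKer.lift_comp (h : IsKer k f) {T : C} (x : T ⟶ A) (hx : IsZeroHom (x ≫ f)) :
    h.lift x hx ≫ k = x :=
  (h.exists_lift x hx).choose_spec

lemma IsKer.mk' [Mono k] (hz : IsZeroHom (k ≫ f))
    (hl : ∀ {T : C} (x : T ⟶ A), IsZeroHom (x ≫ f) → ∃ y : T ⟶ K, y ≫ k = x) : IsKer k f := by
  obtain ⟨t, ht⟩ := hz
  refine ⟨t, ⟨ht⟩, ⟨PullbackCone.IsLimit.mk _ (fun s => (hl s.fst ⟨s.snd, s.condition⟩).choose)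
    (fun s => (hl s.fst ⟨s.snd, s.condition⟩).choose_spec) (fun s => hom_initial_eq _ _) ?_⟩⟩
  intro s m hm _
  rw [← cancel_mono k, hm, (hl s.fst ⟨s.snd, s.condition⟩).choose_spec]

end IsKer

section IsCoker

variable [QuasiPointed C] {K A Q : C} {k : K ⟶ A} {q : A ⟶ Q}

lemma IsCoker.zero (h : IsCoker q k) : IsZeroHom (k ≫ q) := by
  obtain ⟨t, ht⟩ := h
  exact ⟨t, ht.w⟩

lemma IsCoker.epi (h : IsCoker q k) : Epi q := by
  obtain ⟨t, ht⟩ := h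
  exact ⟨fun x y hxy => ht.hom_ext hxy (Subsingleton.elim _ _)⟩

lemma IsCoker.exists_desc (h : IsCoker q k) {T : C} (x : A ⟶ T) (hx : IsZeroHom (k ≫ x)) :
    ∃ y : Q ⟶ T, q ≫ y = x := by
  obtain ⟨t, ht⟩ := h
  obtain ⟨s, hs⟩ := hx
  rw [hom_initial_eq s t] at hs
  exact ⟨ht.desc x (initial.to T) hs, ht.inl_desc _ _ _⟩

lemma IsCoker.mk' [Epi q] (hz : IsZeroHom (k ≫ q))
    (hl : ∀ {T : C} (x : A ⟶ T), IsZeroHom (k ≫ x) → ∃ y : Q ⟶ T, q ≫ y = x) : IsCoker q k := by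
  obtain ⟨t, ht⟩ := hz
  have hs (s : PushoutCocone k t) : IsZeroHom (k ≫ s.inl) :=
    ⟨t, by rw [s.condition]; congr 1; exact Subsingleton.elim _ _⟩
  refine ⟨t, ⟨ht⟩, ⟨PushoutCocone.IsColimit.mk _ (fun s => (hl s.inl (hs s)).choose)
    (fun s => (hl s.inl (hs s)).choose_spec) (fun s => Subsingleton.elim _ _) ?_⟩⟩
  intro s m hm _
  rw [← cancel_epi q, hm, (hl s.inl (hs s)).choose_spec]

end IsCoker

section Ker

variable [QuasiPointed C] [HasPullbacks C]

/-- The object `K[f]`. -/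
def Ker {A B : C} (f : A ⟶ B) : C := pullback f (initial.to B)

/-- The kernel `ker f : K[f] ⟶ A`. -/
def ker {A B : C} (f : A ⟶ B) : Ker f ⟶ A := pullback.fst f (initial.to B)

lemma isKer_ker {A B : C} (f : A ⟶ B) : IsKer (ker f) f :=
  ⟨pullback.snd _ _, IsPullback.of_hasPullback _ _⟩

instance {A B : C} (f : A ⟶ B) : Mono (ker f) := (isKer_ker f).mono

/-- The arrow between kernels that is induced by a commutative square. -/
def kerMap {A B A' B' : C} {f : A ⟶ B} {f' : A' ⟶ B'} (a : A ⟶ A') (b : B ⟶ B')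
    (w : f ≫ b = a ≫ f') : Ker f ⟶ Ker f' :=
  (isKer_ker f').lift (ker f ≫ a) (by
    rw [Category.assoc, ← w, ← Category.assoc]
    exact (isKer_ker f).zero.comp_right b)

@[simp]
lemma kerMap_ker {A B A' B' : C} {f : A ⟶ B} {f' : A' ⟶ B'} (a : A ⟶ A') (b : B ⟶ B')
    (w : f ≫ b = a ≫ f') : kerMap a b w ≫ ker f' = ker f ≫ a :=
  (isKer_ker f').lift_comp _ _

end Ker

end Kernels

/-! ### Quotients by kernels and coequalizers of reflexive relations -/

section Existence

/-- In a protomodular category, a split epimorphism's section and any pullback of the split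
epimorphism jointly cover its domain. -/
lemma isIso_of_point [Protomodular C] {A' A B' B M : C} {p : A ⟶ B} {s : B ⟶ A}
    (hs : s ≫ p = 𝟙 B) {w : A' ⟶ A} {p' : A' ⟶ B'} {w' : B' ⟶ B} (h : IsPullback w p' p w')
    (m : M ⟶ A) [Mono m] (x : A' ⟶ M) (hx : x ≫ m = w) (y : B ⟶ M) (hy : y ≫ m = s) :
    IsIso m := by
  have hsplit : IsSplitEpi (m ≫ p) := ⟨⟨⟨y, by rw [← Category.assoc, hy, hs]⟩⟩⟩
  have hleft : IsPullback x p' (m ≫ p) w' := by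
    refine ⟨⟨by rw [← Category.assoc, hx, h.w]⟩, ⟨PullbackCone.IsLimit.mk _
      (fun t => h.lift (t.fst ≫ m) t.snd (by simpa using t.condition)) ?_ ?_ ?_⟩⟩
    · intro t
      rw [← cancel_mono m, Category.assoc, hx, h.lift_fst]
    · intro t
      rw [h.lift_snd]
    · intro t n h₁ h₂
      refine h.hom_ext ?_ ?_
      · rw [h.lift_fst, ← hx, ← Category.assoc, h₁]
      · rw [h.lift_snd, h₂]
  have houter : IsPullback (x ≫ m) p' p (w' ≫ 𝟙 B) := by
    rw [hx, Category.comp_id]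
    exact h
  have hright := Protomodular.isPullback_right hsplit (by simp) hleft houter
  exact hright.isIso_fst_of_isIso

/-- In a sequentiable category, a regular epimorphism is a cokernel of its kernel. -/
lemma isCoker_of_isRegularEpi [Sequentiable C] {K A B : C} {k : K ⟶ A} {f : A ⟶ B}
    (hk : IsKer k f) (hf : IsRegularEpi f) : IsCoker f k := by
  refine IsCoker.mk' hk.zero ?_
  intro T x hx
  obtain ⟨t, ht⟩ := hk
  let d : A ⟶ pullback f f := pullback.lift (𝟙 A) (𝟙 A) rfl
  let j : K ⟶ pullback f f := pullback.lift (t ≫ initial.to A) k (by rw [ht.w]; simp)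
  have hd₀ : d ≫ pullback.fst f f = 𝟙 A := pullback.lift_fst _ _ _
  have hd₁ : d ≫ pullback.snd f f = 𝟙 A := pullback.lift_snd _ _ _
  have hj₀ : j ≫ pullback.fst f f = t ≫ initial.to A := pullback.lift_fst _ _ _
  have hj₁ : j ≫ pullback.snd f f = k := pullback.lift_snd _ _ _
  have hpb : IsPullback j t (pullback.fst f f) (initial.to A) := by
    refine ⟨⟨hj₀⟩, ⟨PullbackCone.IsLimit.mk _
      (fun s => ht.lift (s.fst ≫ pullback.snd f f) s.snd ?_) ?_ ?_ ?_⟩⟩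
    · rw [Category.assoc, ← pullback.condition, ← Category.assoc, s.condition, Category.assoc]
      congr 1
      exact Subsingleton.elim _ _
    · intro s
      apply pullback.hom_ext
      · rw [Category.assoc, hj₀, ← Category.assoc, ht.lift_snd, s.condition]
      · rw [Category.assoc, hj₁, ht.lift_fst]
    · intro s
      rw [ht.lift_snd]
    · intro s n h₁ h₂
      refine ht.hom_ext ?_ ?_
      · rw [ht.lift_fst, ← h₁, Category.assoc, hj₁]
      · rw [ht.lift_snd, h₂]
  let m := equalizer.ι (pullback.fst f f ≫ x) (pullback.snd f f ≫ x)
  have hiso : IsIso m := by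
    refine isIso_of_point (p := pullback.fst f f) (s := d) hd₀ hpb m
      (equalizer.lift j ?_) (equalizer.lift_ι _ _) (equalizer.lift d ?_) (equalizer.lift_ι _ _)
    · have h1 : IsZeroHom (j ≫ pullback.fst f f ≫ x) :=
        ⟨t, by rw [← Category.assoc, hj₀]; simp⟩
      have h2 : IsZeroHom (j ≫ pullback.snd f f ≫ x) := by
        rw [← Category.assoc, hj₁]
        exact hx
      exact h1.eq h2
    · rw [← Category.assoc, ← Category.assoc, hd₀, hd₁]
  have hcomm : pullback.fst f f ≫ x = pullback.snd f f ≫ x := by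
    rw [← cancel_epi m]
    exact equalizer.condition _ _
  have hc := (IsKernelPair.of_hasPullback f).toCoequalizer'
  exact ⟨Cofork.IsColimit.desc hc x hcomm, Cofork.IsColimit.π_desc' hc _ _⟩

/-- In a sequentiable category, a kernel has a cokernel; the arrow out of the cokernel that is
induced by a morphism of which `k` is a kernel is a monomorphism. -/
lemma exists_isCoker_mono [Sequentiable C] {K A B : C} {k : K ⟶ A} {g : A ⟶ B}
    (hk : IsKer k g) : ∃ (Q : C) (q : A ⟶ Q) (m : Q ⟶ B), IsCoker q k ∧ Mono m ∧ q ≫ m = g := by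
  let F := Regular.strongEpiMonoFactorisation g
  have hm : Mono F.m := F.m_mono
  have hfac : F.e ≫ F.m = g := F.fac
  have : Mono k := hk.mono
  refine ⟨F.I, F.e, F.m, isCoker_of_isRegularEpi ?_ inferInstance, hm, hfac⟩
  refine IsKer.mk' (IsZeroHom.of_comp_mono F.m (by rw [Category.assoc, hfac]; exact hk.zero)) ?_
  intro T x hx
  exact hk.exists_lift x (by rw [← hfac, ← Category.assoc]; exact hx.comp_right _)

lemma IsNormal.exists_isCoker [Sequentiable C] {K A : C} {k : K ⟶ A} (hk : IsNormal k) :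
    ∃ (Q : C) (q : A ⟶ Q), IsCoker q k := by
  obtain ⟨B, g, hg⟩ := hk
  obtain ⟨Q, q, -, hq, -⟩ := exists_isCoker_mono hg
  exact ⟨Q, q, hq⟩

/-- The quotient object `A/K` of `A` by a kernel `k : K ⟶ A`. -/
def Quot [Sequentiable C] {K A : C} (k : K ⟶ A) (hk : IsNormal k) : C :=
  hk.exists_isCoker.choose

/-- The cokernel `A ⟶ A/K` of a kernel `k : K ⟶ A`. -/
def Quot.π [Sequentiable C] {K A : C} (k : K ⟶ A) (hk : IsNormal k) : A ⟶ Quot k hk :=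
  hk.exists_isCoker.choose_spec.choose

section Quot

variable [Sequentiable C] {K A : C} (k : K ⟶ A) (hk : IsNormal k)

lemma Quot.isCoker : IsCoker (Quot.π k hk) k :=
  hk.exists_isCoker.choose_spec.choose_spec

instance : Epi (Quot.π k hk) := (Quot.isCoker k hk).epi

/-- The arrow out of the quotient that is induced by an arrow that kills `k`. -/
def Quot.desc {T : C} (x : A ⟶ T) (hx : IsZeroHom (k ≫ x)) : Quot k hk ⟶ T :=
  ((Quot.isCoker k hk).exists_desc x hx).choose

@[simp]
lemma Quot.π_desc {T : C} (x : A ⟶ T) (hx : IsZeroHom (k ≫ x)) :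
    Quot.π k hk ≫ Quot.desc k hk x hx = x :=
  ((Quot.isCoker k hk).exists_desc x hx).choose_spec

lemma Quot.mono_desc {B : C} {g : A ⟶ B} (h : IsKer k g) : Mono (Quot.desc k hk g h.zero) := by
  obtain ⟨Q, q, m, hq, hm, rfl⟩ := exists_isCoker_mono h
  obtain ⟨i, hi⟩ := (Quot.isCoker k hk).exists_desc q hq.zero
  obtain ⟨j, hj⟩ := hq.exists_desc (Quot.π k hk) (Quot.isCoker k hk).zero
  have := hq.epi
  have hij : i ≫ j = 𝟙 _ := by
    rw [← cancel_epi (Quot.π k hk), ← Category.assoc, hi, hj, Category.comp_id]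
  have hdesc : Quot.desc k hk (q ≫ m) h.zero = i ≫ m := by
    rw [← cancel_epi (Quot.π k hk), Quot.π_desc, ← Category.assoc, hi]
  rw [hdesc]
  have : Mono i := ⟨fun a b hab => by
    have := congrArg (· ≫ j) hab
    simpa [hij] using this⟩
  exact mono_comp _ _

/-- The arrow between quotients that is induced by a commutative square. -/
def Quot.map {K' A' : C} (k' : K' ⟶ A') (hk' : IsNormal k') (u : K ⟶ K') (a : A ⟶ A')
    (w : k ≫ a = u ≫ k') : Quot k hk ⟶ Quot k' hk' :=
  Quot.desc k hk (a ≫ Quot.π k' hk') (by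
    rw [← Category.assoc, w, Category.assoc]
    exact (Quot.isCoker k' hk').zero.comp_left u)

@[simp]
lemma Quot.π_map {K' A' : C} (k' : K' ⟶ A') (hk' : IsNormal k') (u : K ⟶ K') (a : A ⟶ A')
    (w : k ≫ a = u ≫ k') :
    Quot.π k hk ≫ Quot.map k hk k' hk' u a w = a ≫ Quot.π k' hk' :=
  Quot.π_desc _ _ _ _

end Quot

/-- In a finitely complete protomodular category, a reflexive relation is transitive. -/
lemma exists_transitivity [Protomodular C] [HasFiniteLimits C] {R X : C} {r₀ r₁ : R ⟶ X}
    (hmono : JointlyMono₂ r₀ r₁) (e : X ⟶ R) (h₀ : e ≫ r₀ = 𝟙 X) (h₁ : e ≫ r₁ = 𝟙 X) :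
    ∃ t : pullback r₁ r₀ ⟶ R, t ≫ r₀ = pullback.fst r₁ r₀ ≫ r₀ ∧
      t ≫ r₁ = pullback.snd r₁ r₀ ≫ r₁ := by
  let T := pullback r₁ r₀
  let a : T ⟶ R := pullback.fst r₁ r₀
  let b : T ⟶ R := pullback.snd r₁ r₀
  have hab : a ≫ r₁ = b ≫ r₀ := pullback.condition
  let i : R ⟶ T := pullback.lift (𝟙 R) (r₁ ≫ e) (by simp [h₀])
  let j : R ⟶ T := pullback.lift (r₀ ≫ e) (𝟙 R) (by simp [h₁])
  have hia : i ≫ a = 𝟙 R := pullback.lift_fst _ _ _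
  have hib : i ≫ b = r₁ ≫ e := pullback.lift_snd _ _ _
  have hja : j ≫ a = r₀ ≫ e := pullback.lift_fst _ _ _
  have hjb : j ≫ b = 𝟙 R := pullback.lift_snd _ _ _
  have hpb : IsPullback i r₁ b e := by
    refine ⟨⟨hib⟩, ⟨PullbackCone.IsLimit.mk _ (fun s => s.fst ≫ a) ?_ ?_ ?_⟩⟩
    · intro s
      have hs : s.fst ≫ a ≫ r₁ = s.snd := by
        rw [hab, ← Category.assoc, s.condition, Category.assoc, h₀, Category.comp_id]
      apply pullback.hom_ext
      · change ((s.fst ≫ a) ≫ i) ≫ a = s.fst ≫ a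
        rw [Category.assoc, hia, Category.comp_id]
      · change ((s.fst ≫ a) ≫ i) ≫ b = s.fst ≫ b
        rw [Category.assoc, hib, s.condition, ← hs]
        simp
    · intro s
      rw [Category.assoc, hab, ← Category.assoc, s.condition, Category.assoc, h₀, Category.comp_id]
    · intro s n hn _
      rw [← hn, Category.assoc, hia, Category.comp_id]
  let f : T ⟶ X ⨯ X := prod.lift (a ≫ r₀) (b ≫ r₁)
  let g : R ⟶ X ⨯ X := prod.lift r₀ r₁
  have hf₀ : f ≫ prod.fst = a ≫ r₀ := prod.lift_fst _ _
  have hf₁ : f ≫ prod.snd = b ≫ r₁ := prod.lift_snd _ _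
  have hg₀ : g ≫ prod.fst = r₀ := prod.lift_fst _ _
  have hg₁ : g ≫ prod.snd = r₁ := prod.lift_snd _ _
  have hg : Mono g := ⟨fun x y hxy => hmono.right_cancellation x y
    (by rw [← hg₀, ← Category.assoc, hxy, Category.assoc])
    (by rw [← hg₁, ← Category.assoc, hxy, Category.assoc])⟩
  let m : pullback f g ⟶ T := pullback.fst f g
  have hm : IsIso m := by
    refine isIso_of_point hjb hpb m (pullback.lift i (𝟙 R) ?_) (pullback.lift_fst _ _ _)
      (pullback.lift j (𝟙 R) ?_) (pullback.lift_fst _ _ _)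
    · apply Limits.prod.hom_ext
      · rw [Category.assoc, Category.assoc, hf₀, hg₀, ← Category.assoc, hia]
      · rw [Category.assoc, Category.assoc, hf₁, hg₁, ← Category.assoc, hib, Category.assoc, h₁,
          Category.comp_id, Category.id_comp]
    · apply Limits.prod.hom_ext
      · rw [Category.assoc, Category.assoc, hf₀, hg₀, ← Category.assoc, hja, Category.assoc, h₀,
          Category.comp_id, Category.id_comp]
      · rw [Category.assoc, Category.assoc, hf₁, hg₁, ← Category.assoc, hjb]
  have hcond : inv m ≫ pullback.snd f g ≫ g = f := by
    rw [IsIso.inv_comp_eq]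
    exact pullback.condition.symm
  refine ⟨inv m ≫ pullback.snd f g, ?_, ?_⟩
  · have h := congrArg (· ≫ prod.fst) hcond
    simp only [Category.assoc, hg₀] at h
    rw [Category.assoc]
    exact h.trans hf₀
  · have h := congrArg (· ≫ prod.snd) hcond
    simp only [Category.assoc, hg₁] at h
    rw [Category.assoc]
    exact h.trans hf₁

end Existence

/-! ### Birkhoff subfunctors -/

variable (C) in
/-- A Birkhoff subfunctor: a subfunctor `μ : V ⟶ 𝟭 C` of the identity functor, all of whose
components are kernels, such that `V` preserves regular epimorphisms. -/
structure BirkhoffSubfunctor [HasInitial C] where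
  /-- the functor `V` -/
  V : C ⥤ C
  /-- the inclusion into the identity functor -/
  μ : V ⟶ 𝟭 C
  normal : ∀ A : C, IsNormal (μ.app A)
  map_regularEpi : ∀ {A B : C} (f : A ⟶ B), IsRegularEpi f → IsRegularEpi (V.map f)

variable (C) in
/-- A choice of projective presentations: a graph morphism from `C` to the web of projective
presentations, choosing a projective presentation `π A : obj A ⟶ A` of every object `A` and, over
every morphism `f`, a morphism between the chosen presentations. -/
structure ProjectiveChoice where
  /-- the presenting objects -/
  obj : C → C
  /-- the presentations -/
  π : ∀ A : C, obj A ⟶ A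
  projective : ∀ A : C, IsRegularProjective (obj A)
  regularEpi : ∀ A : C, IsRegularEpi (π A)
  /-- the chosen morphisms of presentations -/
  map : ∀ {A B : C}, (A ⟶ B) → (obj A ⟶ obj B)
  comm : ∀ {A B : C} (f : A ⟶ B), map f ≫ π B = π A ≫ f

instance [EnoughRegularProjectives C] : Nonempty (ProjectiveChoice C) := by
  choose P p hP hp using EnoughRegularProjectives.exists_presentation (C := C)
  choose m hm using fun (A B : C) (f : A ⟶ B) => hP A (p B) (hp B) (p A ≫ f)
  exact ⟨⟨P, p, hP, hp, fun {A B} f => m A B f, fun {A B} f => hm A B f⟩⟩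

namespace BirkhoffSubfunctor

section Reflector

variable [Sequentiable C] (V : BirkhoffSubfunctor C)

/-- The inclusion `μ_A : V(A) ⟶ A`. -/
def incl (A : C) : V.V.obj A ⟶ A := V.μ.app A

lemma normal_incl (A : C) : IsNormal (V.incl A) := V.normal A

instance (A : C) : Mono (V.incl A) := by
  obtain ⟨_, _, h⟩ := V.normal_incl A
  exact h.mono

lemma incl_naturality {A B : C} (f : A ⟶ B) : V.V.map f ≫ V.incl B = V.incl A ≫ f :=
  V.μ.naturality f

/-- The functor `U`, with `U(A)` the cokernel of `μ_A : V(A) ⟶ A`. -/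
def U : C ⥤ C where
  obj A := Quot (V.incl A) (V.normal_incl A)
  map {A B} f := Quot.map _ (V.normal_incl A) _ (V.normal_incl B) (V.V.map f) f
    (V.incl_naturality f).symm
  map_id A := by rw [← cancel_epi (Quot.π _ (V.normal_incl A))]; simp
  map_comp {A B D} f g := by
    rw [← cancel_epi (Quot.π _ (V.normal_incl A))]
    refine (Quot.π_map _ _ _ _ _ _ _).trans (Eq.symm ?_)
    rw [← Category.assoc, Quot.π_map, Category.assoc, Quot.π_map, Category.assoc]

/-- The cokernel `η_A : A ⟶ U(A)` of `μ_A`. -/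
def η (A : C) : A ⟶ V.U.obj A := Quot.π _ (V.normal_incl A)

/-! The functor `K[·] ∩ V₀`. -/

/-- The intersection `K[p] ∩ V(A₀)` of the subobjects `K[p]` and `V(A₀)` of `A₀`. -/
def KV {A₀ A : C} (p : A₀ ⟶ A) : C := pullback (V.incl A₀) (ker p)

/-- The inclusion of `K[p] ∩ V(A₀)` into `V(A₀)`. -/
def KVι {A₀ A : C} (p : A₀ ⟶ A) : V.KV p ⟶ V.V.obj A₀ := pullback.fst _ _

instance {A₀ A : C} (p : A₀ ⟶ A) : Mono (V.KVι p) := by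
  unfold KVι KV
  infer_instance

lemma zero_KVι {A₀ A : C} (p : A₀ ⟶ A) : IsZeroHom (V.KVι p ≫ V.incl A₀ ≫ p) := by
  have h : V.KVι p ≫ V.incl A₀ ≫ p =
      (show V.KV p ⟶ Ker p from pullback.snd _ _) ≫ ker p ≫ p := by
    rw [← Category.assoc, ← Category.assoc]
    exact congrArg (· ≫ p) pullback.condition
  rw [h]
  exact (isKer_ker p).zero.comp_left _

/-- A morphism to `V(A₀)` that is killed by `p` factors through `K[p] ∩ V(A₀)`. -/
def KVlift {T A₀ A : C} (p : A₀ ⟶ A) (x : T ⟶ V.V.obj A₀)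
    (hx : IsZeroHom (x ≫ V.incl A₀ ≫ p)) : T ⟶ V.KV p :=
  pullback.lift x ((isKer_ker p).lift (x ≫ V.incl A₀) (by rw [Category.assoc]; exact hx))
    (by simp)

@[simp]
lemma KVlift_ι {T A₀ A : C} (p : A₀ ⟶ A) (x : T ⟶ V.V.obj A₀)
    (hx : IsZeroHom (x ≫ V.incl A₀ ≫ p)) : V.KVlift p x hx ≫ V.KVι p = x :=
  pullback.lift_fst _ _ _

/-- The action of `K[·] ∩ V₀` on morphisms of presentations. -/
def KVmap {A₀ A B₀ B : C} {p : A₀ ⟶ A} {q : B₀ ⟶ B} (f₀ : A₀ ⟶ B₀) (f : A ⟶ B)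
    (w : f₀ ≫ q = p ≫ f) : V.KV p ⟶ V.KV q :=
  V.KVlift q (V.KVι p ≫ V.V.map f₀) (by
    have h : (V.KVι p ≫ V.V.map f₀) ≫ V.incl B₀ ≫ q = (V.KVι p ≫ V.incl A₀ ≫ p) ≫ f := by
      simp only [Category.assoc, ← w]
      rw [← Category.assoc (V.V.map f₀), V.incl_naturality, Category.assoc]
    rw [h]
    exact (V.zero_KVι p).comp_right f)

lemma KVmap_ι {A₀ A B₀ B : C} {p : A₀ ⟶ A} {q : B₀ ⟶ B} (f₀ : A₀ ⟶ B₀) (f : A ⟶ B)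
    (w : f₀ ≫ q = p ≫ f) : V.KVmap f₀ f w ≫ V.KVι q = V.KVι p ≫ V.V.map f₀ :=
  V.KVlift_ι _ _ _

end Reflector

section V₁

variable [BarrExact C] [Sequentiable C] (V : BirkhoffSubfunctor C)

/-- The image under `V` of a kernel pair is an equivalence relation, hence it is the kernel pair
of some morphism and has a coequalizer. -/
instance hasCoequalizer {A₀ A : C} (p : A₀ ⟶ A) :
    HasCoequalizer (V.V.map (pullback.fst p p)) (V.V.map (pullback.snd p p)) := by
  let d : A₀ ⟶ pullback p p := pullback.lift (𝟙 A₀) (𝟙 A₀) rfl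
  let s : pullback p p ⟶ pullback p p :=
    pullback.lift (pullback.snd p p) (pullback.fst p p) pullback.condition.symm
  have hmono : JointlyMono₂ (V.V.map (pullback.fst p p)) (V.V.map (pullback.snd p p)) := by
    refine ⟨fun Y f g h₁ h₂ => ?_⟩
    rw [← cancel_mono (V.incl _)]
    apply pullback.hom_ext
    · rw [Category.assoc, Category.assoc, ← V.incl_naturality, ← Category.assoc, h₁,
        Category.assoc]
    · rw [Category.assoc, Category.assoc, ← V.incl_naturality, ← Category.assoc, h₂,
        Category.assoc]
  have hd₀ : V.V.map d ≫ V.V.map (pullback.fst p p) = 𝟙 _ := by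
    rw [← V.V.map_comp, pullback.lift_fst, V.V.map_id]
  have hd₁ : V.V.map d ≫ V.V.map (pullback.snd p p) = 𝟙 _ := by
    rw [← V.V.map_comp, pullback.lift_snd, V.V.map_id]
  obtain ⟨t, ht₀, ht₁⟩ := exists_transitivity hmono (V.V.map d) hd₀ hd₁
  have hE : IsEquivalenceRelation (V.V.map (pullback.fst p p)) (V.V.map (pullback.snd p p)) :=
    ⟨⟨{ right_cancellation := hmono.right_cancellation
        r := V.V.map d
        reflexivity₁ := hd₀
        reflexivity₂ := hd₁
        s := V.V.map s
        symmetry₁ := by rw [← V.V.map_comp]; exact congrArg V.V.map (pullback.lift_fst _ _ _)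
        symmetry₂ := by rw [← V.V.map_comp]; exact congrArg V.V.map (pullback.lift_snd _ _ _)
        c := _
        isLimit := pullbackIsPullback _ _
        t := t
        transitivity₁ := ht₀
        transitivity₂ := ht₁ }⟩⟩
  obtain ⟨B, f, hf⟩ := BarrExact.exists_isKernelPair _ _ hE
  exact Regular.hasCoequalizer_of_isKernelPair hf

/-- The coequalizer of the image under `V` of the kernel pair of `p : A₀ ⟶ A`. -/
def coeq {A₀ A : C} (p : A₀ ⟶ A) :
    V.V.obj A₀ ⟶ coequalizer (V.V.map (pullback.fst p p)) (V.V.map (pullback.snd p p)) :=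
  coequalizer.π _ _

/-- The object `V₁p`, the kernel of the coequalizer of the image under `V` of the kernel pair
of `p`. -/
def V₁ {A₀ A : C} (p : A₀ ⟶ A) : C := Ker (V.coeq p)

/-- The inclusion of `V₁p` into `V(A₀)`. -/
def V₁ι {A₀ A : C} (p : A₀ ⟶ A) : V.V₁ p ⟶ V.V.obj A₀ := ker (V.coeq p)

instance {A₀ A : C} (p : A₀ ⟶ A) : Mono (V.V₁ι p) := by
  unfold V₁ι V₁
  infer_instance

lemma isKer_V₁ι {A₀ A : C} (p : A₀ ⟶ A) : IsKer (V.V₁ι p) (V.coeq p) := isKer_ker _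

lemma normal_V₁ι {A₀ A : C} (p : A₀ ⟶ A) : IsNormal (V.V₁ι p) := ⟨_, _, V.isKer_V₁ι p⟩

lemma map_comp_coeq {X A₀ A : C} {p : A₀ ⟶ A} {f g : X ⟶ A₀} (h : f ≫ p = g ≫ p) :
    V.V.map f ≫ V.coeq p = V.V.map g ≫ V.coeq p := by
  have hf : f = pullback.lift f g h ≫ pullback.fst p p := (pullback.lift_fst _ _ _).symm
  have hg : g = pullback.lift f g h ≫ pullback.snd p p := (pullback.lift_snd _ _ _).symm
  have hfg : V.V.map (pullback.fst p p) ≫ V.coeq p = V.V.map (pullback.snd p p) ≫ V.coeq p :=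
    coequalizer.condition _ _
  calc V.V.map f ≫ V.coeq p
      = V.V.map (pullback.lift f g h) ≫ V.V.map (pullback.fst p p) ≫ V.coeq p := by
        rw [← Category.assoc, ← V.V.map_comp, ← hf]
    _ = V.V.map (pullback.lift f g h) ≫ V.V.map (pullback.snd p p) ≫ V.coeq p := by rw [hfg]
    _ = V.V.map g ≫ V.coeq p := by rw [← Category.assoc, ← V.V.map_comp, ← hg]

lemma zero_V₁ι_map {A₀ A : C} (p : A₀ ⟶ A) : IsZeroHom (V.V₁ι p ≫ V.V.map p) := by
  have hp : V.V.map p = V.coeq p ≫ coequalizer.desc (V.V.map p)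
      (by rw [← V.V.map_comp, ← V.V.map_comp, pullback.condition]) := by simp [coeq]
  rw [hp, ← Category.assoc]
  exact (V.isKer_V₁ι p).zero.comp_right _

lemma zero_V₁ι_μ {A₀ A : C} (p : A₀ ⟶ A) : IsZeroHom (V.V₁ι p ≫ V.incl A₀ ≫ p) := by
  rw [← V.incl_naturality, ← Category.assoc]
  exact (V.zero_V₁ι_map p).comp_right _

/-- The action of `V₁` on morphisms of presentations. -/
def V₁map {A₀ A B₀ B : C} {p : A₀ ⟶ A} {q : B₀ ⟶ B} (f₀ : A₀ ⟶ B₀) (f : A ⟶ B)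
    (w : f₀ ≫ q = p ≫ f) : V.V₁ p ⟶ V.V₁ q :=
  kerMap (V.V.map f₀) (coequalizer.desc (V.V.map f₀ ≫ V.coeq q) (by
      rw [← Category.assoc, ← Category.assoc, ← V.V.map_comp, ← V.V.map_comp]
      exact V.map_comp_coeq (by simp [w, pullback.condition_assoc])))
    (coequalizer.π_desc _ _)

lemma V₁map_ι {A₀ A B₀ B : C} {p : A₀ ⟶ A} {q : B₀ ⟶ B} (f₀ : A₀ ⟶ B₀) (f : A ⟶ B)
    (w : f₀ ≫ q = p ≫ f) : V.V₁map f₀ f w ≫ V.V₁ι q = V.V₁ι p ≫ V.V.map f₀ :=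
  kerMap_ker _ _ _

/-- The inclusion of `V₁p` into `K[p] ∩ V(A₀)`. -/
def V₁toKV {A₀ A : C} (p : A₀ ⟶ A) : V.V₁ p ⟶ V.KV p :=
  V.KVlift p (V.V₁ι p) (V.zero_V₁ι_μ p)

lemma V₁toKV_ι {A₀ A : C} (p : A₀ ⟶ A) : V.V₁toKV p ≫ V.KVι p = V.V₁ι p :=
  V.KVlift_ι _ _ _

lemma V₁toKV_KVmap {A₀ A B₀ B : C} {p : A₀ ⟶ A} {q : B₀ ⟶ B} (f₀ : A₀ ⟶ B₀) (f : A ⟶ B)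
    (w : f₀ ≫ q = p ≫ f) : V.V₁toKV p ≫ V.KVmap f₀ f w = V.V₁map f₀ f w ≫ V.V₁toKV q := by
  rw [← cancel_mono (V.KVι q), Category.assoc, V.KVmap_ι, Category.assoc, V.V₁toKV_ι, V.V₁map_ι,
    ← Category.assoc, V.V₁toKV_ι]

/-- The quotient `V(A₀) ⟶ V(A₀)/V₁p`. -/
def DVπ {A₀ A : C} (p : A₀ ⟶ A) : V.V.obj A₀ ⟶ Quot (V.V₁ι p) (V.normal_V₁ι p) := Quot.π _ _

instance {A₀ A : C} (p : A₀ ⟶ A) : Epi (V.DVπ p) := by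
  unfold DVπ
  infer_instance

lemma isKer_DVπ {A₀ A : C} (p : A₀ ⟶ A) : IsKer (V.V₁ι p) (V.DVπ p) := by
  refine IsKer.mk' (Quot.isCoker _ _).zero ?_
  intro T x hx
  refine (V.isKer_V₁ι p).exists_lift x ?_
  have : V.coeq p = V.DVπ p ≫ Quot.desc _ (V.normal_V₁ι p) (V.coeq p) (V.isKer_V₁ι p).zero :=
    (Quot.π_desc _ _ _ _).symm
  rw [this, ← Category.assoc]
  exact hx.comp_right _

lemma isKer_V₁toKV {A₀ A : C} (p : A₀ ⟶ A) :
    IsKer (V.V₁toKV p) (V.KVι p ≫ V.DVπ p) := by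
  have hm : Mono (V.V₁toKV p) := by
    have : Mono (V.V₁toKV p ≫ V.KVι p) := by
      rw [V.V₁toKV_ι]
      infer_instance
    exact mono_of_mono _ (V.KVι p)
  refine IsKer.mk' ?_ ?_
  · rw [← Category.assoc, V.V₁toKV_ι]
    exact (V.isKer_DVπ p).zero
  · intro T x hx
    rw [← Category.assoc] at hx
    obtain ⟨y, hy⟩ := (V.isKer_DVπ p).exists_lift _ hx
    exact ⟨y, by rw [← cancel_mono (V.KVι p), Category.assoc, V.V₁toKV_ι, hy]⟩

lemma normal_V₁toKV {A₀ A : C} (p : A₀ ⟶ A) : IsNormal (V.V₁toKV p) :=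
  ⟨_, _, V.isKer_V₁toKV p⟩

/-- Homotopic morphisms of presentations induce the same arrow. -/
lemma map_comp_DVπ {X A₀ A : C} {p : A₀ ⟶ A} {f g : X ⟶ A₀} (h : f ≫ p = g ≫ p) :
    V.V.map f ≫ V.DVπ p = V.V.map g ≫ V.DVπ p := by
  have hc : V.DVπ p ≫ Quot.desc _ (V.normal_V₁ι p) (V.coeq p) (V.isKer_V₁ι p).zero = V.coeq p :=
    Quot.π_desc _ _ _ _
  have : Mono (Quot.desc _ (V.normal_V₁ι p) (V.coeq p) (V.isKer_V₁ι p).zero) :=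
    Quot.mono_desc _ _ (V.isKer_V₁ι p)
  rw [← cancel_mono (Quot.desc _ (V.normal_V₁ι p) (V.coeq p) (V.isKer_V₁ι p).zero),
    Category.assoc, Category.assoc, hc]
  exact V.map_comp_coeq h

end V₁

/-! ### The functors `DV` and `ΔV` -/

section Baer

variable [BarrExact C] [Sequentiable C] (V : BirkhoffSubfunctor C) (c : ProjectiveChoice C)

/-- The functor `DV`, sending `A` with chosen presentation `p : A₀ ⟶ A` to `V(A₀)/V₁p`. -/
def D : C ⥤ C where
  obj A := Quot (V.V₁ι (c.π A)) (V.normal_V₁ι (c.π A))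
  map {A B} f := Quot.map _ _ _ _ (V.V₁map (c.map f) f (c.comm f)) (V.V.map (c.map f))
    (V.V₁map_ι _ _ _).symm
  map_id A := by
    rw [← cancel_epi (V.DVπ (c.π A))]
    refine (Quot.π_map _ _ _ _ _ _ _).trans ?_
    refine (V.map_comp_DVπ (g := 𝟙 _) (by simp [c.comm])).trans ?_
    simp [DVπ]
  map_comp {A B E} f g := by
    rw [← cancel_epi (V.DVπ (c.π A))]
    refine (Quot.π_map _ _ _ _ _ _ _).trans ?_
    refine (V.map_comp_DVπ (g := c.map f ≫ c.map g) ?_).trans (Eq.symm ?_)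
    · rw [c.comm, Category.assoc, c.comm, ← Category.assoc, ← Category.assoc, c.comm]
    · unfold DVπ
      rw [← Category.assoc, Quot.π_map, Category.assoc, Quot.π_map, V.V.map_comp, Category.assoc]

/-- The quotient `V(A₀) ⟶ DV(A) = V(A₀)/V₁p`, for `p : A₀ ⟶ A` the chosen presentation. -/
def Dπ (A : C) : V.V.obj (c.obj A) ⟶ (V.D c).obj A := V.DVπ (c.π A)

instance (A : C) : Epi (V.Dπ c A) := inferInstanceAs (Epi (V.DVπ (c.π A)))

lemma Dπ_map {A B : C} (f : A ⟶ B) :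
    V.Dπ c A ≫ (V.D c).map f = V.V.map (c.map f) ≫ V.Dπ c B :=
  Quot.π_map (V.V₁ι (c.π A)) (V.normal_V₁ι _) (V.V₁ι (c.π B)) (V.normal_V₁ι _)
    (V.V₁map (c.map f) f (c.comm f)) (V.V.map (c.map f)) (V.V₁map_ι _ _ _).symm

lemma isKer_V₁toKV' (A : C) : IsKer (V.V₁toKV (c.π A)) (V.KVι (c.π A) ≫ V.Dπ c A) :=
  V.isKer_V₁toKV (c.π A)

/-- The object `ΔV(A) = (K[p] ∩ V(A₀))/V₁p`, for `p : A₀ ⟶ A` the chosen presentation. -/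
def Δobj (A : C) : C := Quot (V.V₁toKV (c.π A)) (V.normal_V₁toKV (c.π A))

/-- The quotient `K[p] ∩ V(A₀) ⟶ ΔV(A)`. -/
def Δπ (A : C) : V.KV (c.π A) ⟶ V.Δobj c A := Quot.π _ _

instance (A : C) : Epi (V.Δπ c A) := by
  unfold Δπ Δobj
  infer_instance

/-- The canonical arrow `ΔV(A) ⟶ DV(A)`, induced by the inclusion of `K[p] ∩ V(A₀)` into
`V(A₀)`. -/
def Δι (A : C) : V.Δobj c A ⟶ (V.D c).obj A :=
  Quot.desc _ _ (V.KVι (c.π A) ≫ V.Dπ c A) (V.isKer_V₁toKV' c A).zero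

instance (A : C) : Mono (V.Δι c A) := Quot.mono_desc _ _ (V.isKer_V₁toKV' c A)

lemma Δπ_ι (A : C) : V.Δπ c A ≫ V.Δι c A = V.KVι (c.π A) ≫ V.Dπ c A :=
  Quot.π_desc _ _ _ _

/-- The action of `ΔV` on morphisms. -/
def Δmap {A B : C} (f : A ⟶ B) : V.Δobj c A ⟶ V.Δobj c B :=
  Quot.map _ _ _ _ (V.V₁map (c.map f) f (c.comm f)) (V.KVmap (c.map f) f (c.comm f))
    (V.V₁toKV_KVmap _ _ _)

lemma Δπ_map {A B : C} (f : A ⟶ B) :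
    V.Δπ c A ≫ V.Δmap c f = V.KVmap (c.map f) f (c.comm f) ≫ V.Δπ c B :=
  Quot.π_map _ _ _ _ _ _ _

lemma Δmap_ι {A B : C} (f : A ⟶ B) : V.Δmap c f ≫ V.Δι c B = V.Δι c A ≫ (V.D c).map f := by
  rw [← cancel_epi (V.Δπ c A), ← Category.assoc, Δπ_map, Category.assoc, Δπ_ι, ← Category.assoc,
    KVmap_ι, ← Category.assoc, Δπ_ι, Category.assoc, Category.assoc, Dπ_map]

/-- The functor `ΔV`, sending `A` with chosen presentation `p : A₀ ⟶ A` to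
`(K[p] ∩ V(A₀))/V₁p`. -/
def Δ : C ⥤ C where
  obj A := V.Δobj c A
  map f := V.Δmap c f
  map_id A := by
    rw [← cancel_mono (V.Δι c A), Δmap_ι]
    simp
  map_comp {A B E} f g := by
    rw [← cancel_mono (V.Δι c E), Δmap_ι, Category.assoc, Δmap_ι, ← Category.assoc, Δmap_ι]
    simp

/-- The arrow `α_A : DV(A) ⟶ A`, induced by `V(A₀) ⟶ A₀ ⟶ A`. -/
def α (A : C) : (V.D c).obj A ⟶ A :=
  Quot.desc (V.V₁ι (c.π A)) (V.normal_V₁ι (c.π A)) (V.incl (c.obj A) ≫ c.π A)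
    (V.zero_V₁ι_μ (c.π A))

lemma Dπ_α (A : C) : V.Dπ c A ≫ V.α c A = V.incl (c.obj A) ≫ c.π A :=
  Quot.π_desc (V.V₁ι (c.π A)) (V.normal_V₁ι (c.π A)) _ _

lemma α_naturality {A B : C} (f : A ⟶ B) : (V.D c).map f ≫ V.α c B = V.α c A ≫ f := by
  rw [← cancel_epi (V.Dπ c A), ← Category.assoc, Dπ_map, Category.assoc, Dπ_α,
    ← Category.assoc, incl_naturality, Category.assoc, c.comm, ← Category.assoc, ← Category.assoc,
    Dπ_α]

end Baer

end BirkhoffSubfunctor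

/-! ### The category of short exact sequences -/

variable (C) in
/-- Short exact sequences in `C`. -/
structure SES [HasInitial C] where
  /-- the left-hand object -/
  K : C
  /-- the middle object -/
  A : C
  /-- the right-hand object -/
  B : C
  /-- the kernel -/
  k : K ⟶ A
  /-- the cokernel -/
  f : A ⟶ B
  shortExact : IsShortExact k f

namespace SES

/-- Morphisms of short exact sequences. -/
@[ext]
structure Hom [HasInitial C] (S T : SES C) where
  /-- the left-hand component -/
  κ : S.K ⟶ T.K
  /-- the middle component -/
  a : S.A ⟶ T.A
  /-- the right-hand component -/
  b : S.B ⟶ T.B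
  comm_k : S.k ≫ a = κ ≫ T.k
  comm_f : S.f ≫ b = a ≫ T.f

instance [HasInitial C] : Category (SES C) where
  Hom S T := Hom S T
  id S := ⟨𝟙 _, 𝟙 _, 𝟙 _, by simp, by simp⟩
  comp f g := ⟨f.κ ≫ g.κ, f.a ≫ g.a, f.b ≫ g.b,
    by rw [← Category.assoc, f.comm_k, Category.assoc, g.comm_k, Category.assoc],
    by rw [← Category.assoc, f.comm_f, Category.assoc, g.comm_f, Category.assoc]⟩
  id_comp f := by apply Hom.ext <;> simp
  comp_id f := by apply Hom.ext <;> simp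
  assoc f g h := by apply Hom.ext <;> simp

variable (C) in
/-- The functor `(K ⟶ A ⟶ B) ↦ K`. -/
def left [HasInitial C] : SES C ⥤ C where
  obj S := S.K
  map φ := φ.κ
  map_id _ := rfl
  map_comp _ _ := rfl

variable (C) in
/-- The functor `(K ⟶ A ⟶ B) ↦ A`. -/
def middle [HasInitial C] : SES C ⥤ C where
  obj S := S.A
  map φ := φ.a
  map_id _ := rfl
  map_comp _ _ := rfl

variable (C) in
/-- The functor `(K ⟶ A ⟶ B) ↦ B`. -/
def right [HasInitial C] : SES C ⥤ C where
  obj S := S.B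
  map φ := φ.b
  map_id _ := rfl
  map_comp _ _ := rfl

end SES

namespace BirkhoffSubfunctor

variable [BarrExact C] [Sequentiable C] (V : BirkhoffSubfunctor C) (c : ProjectiveChoice C)

/-- The inclusion of `V₁f` into `K`, for a short exact sequence `K ⟶ A ⟶ B` with cokernel `f`. -/
def V₁toK (S : SES C) : V.V₁ S.f ⟶ S.K :=
  S.shortExact.1.lift (V.V₁ι S.f ≫ V.incl S.A) (by
    rw [Category.assoc]
    exact V.zero_V₁ι_μ S.f)

/-- The arrow `γ : K[DVf] ⟶ K` induced by `α`. -/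
def γ (S : SES C) : Ker ((V.D c).map S.f) ⟶ S.K :=
  S.shortExact.1.lift (ker ((V.D c).map S.f) ≫ V.α c S.A) (by
    rw [Category.assoc, ← α_naturality, ← Category.assoc]
    exact (isKer_ker _).zero.comp_right _)

lemma γ_k (S : SES C) : V.γ c S ≫ S.k = ker ((V.D c).map S.f) ≫ V.α c S.A :=
  S.shortExact.1.lift_comp _ _

/-- The arrow `K[DVf] ⟶ K[DVf']` induced by a morphism of short exact sequences. -/
def kerDmap {S T : SES C} (φ : S ⟶ T) : Ker ((V.D c).map S.f) ⟶ Ker ((V.D c).map T.f) :=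
  kerMap ((V.D c).map φ.a) ((V.D c).map φ.b)
    (by rw [← (V.D c).map_comp, ← (V.D c).map_comp, φ.comm_f])

lemma kerDmap_ker {S T : SES C} (φ : S ⟶ T) :
    V.kerDmap c φ ≫ ker ((V.D c).map T.f) = ker ((V.D c).map S.f) ≫ (V.D c).map φ.a :=
  kerMap_ker _ _ _

lemma γ_naturality {S T : SES C} (φ : S ⟶ T) :
    V.γ c S ≫ φ.κ = V.kerDmap c φ ≫ V.γ c T := by
  have := T.shortExact.1.mono
  rw [← cancel_mono T.k, Category.assoc, ← φ.comm_k, ← Category.assoc, γ_k, Category.assoc,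
    ← α_naturality, Category.assoc, γ_k, ← Category.assoc, ← Category.assoc, kerDmap_ker]

/-- The arrow `K[γ] ⟶ K[γ']` induced by a morphism of short exact sequences. -/
def Kγmap {S T : SES C} (φ : S ⟶ T) : Ker (V.γ c S) ⟶ Ker (V.γ c T) :=
  kerMap (V.kerDmap c φ) φ.κ (V.γ_naturality c φ)

lemma Kγmap_ker {S T : SES C} (φ : S ⟶ T) :
    V.Kγmap c φ ≫ ker (V.γ c T) ≫ ker ((V.D c).map T.f) =
      (ker (V.γ c S) ≫ ker ((V.D c).map S.f)) ≫ (V.D c).map φ.a := by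
  rw [← Category.assoc, Kγmap, kerMap_ker, Category.assoc, kerDmap_ker, ← Category.assoc]

/-- The functor sending a short exact sequence to `K[γ]`. -/
def Kγ : SES C ⥤ C where
  obj S := Ker (V.γ c S)
  map φ := V.Kγmap c φ
  map_id S := by
    rw [← cancel_mono (ker (V.γ c S) ≫ ker ((V.D c).map S.f)), Kγmap_ker]
    change _ ≫ (V.D c).map (𝟙 S.A) = _
    simp
  map_comp {S T W} φ ψ := by
    rw [← cancel_mono (ker (V.γ c W) ≫ ker ((V.D c).map W.f))]
    refine (V.Kγmap_ker c (φ ≫ ψ)).trans (Eq.symm ?_)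
    rw [Category.assoc, Kγmap_ker, ← Category.assoc, Kγmap_ker, Category.assoc,
      ← (V.D c).map_comp]
    rfl

end BirkhoffSubfunctor

end

end Baer

open Baer

namespace Baer

noncomputable section

variable {C : Type u} [Category.{v} C]

/-! ### Regular epimorphisms and local lifts -/

section Covers

/-! Write `p : A₀ ⟶ A` for the chosen presentation. Then `p ≫ f` is a regular epimorphism onto `B`
with projective domain, and up to isomorphism `ΔV(B)` may be computed from it: `coverΔ` is a regular
epimorphism from `K[pf] ∩ V(A₀)` to `ΔV(B)` with kernel `V₁(pf)`. On this cover `p` induces an arrow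
`KVtoK` to `K` with kernel `K[p] ∩ V(A₀)`. It carries `V₁(pf)` into `V₁f`, which gives the
connecting arrow `ΔV(B) ⟶ K/V₁f`.

Exactness is checked on generalized elements, locally for regular epimorphisms (`exactAt_of_cover`).
There is no subtraction, and protomodularity replaces it through `exists_cover_ker`: if `J` covers
`X` through `g : N ⟶ X` and `h` kills `J`, then every value of `h` is locally a value of `h` on the
kernel of `g`. For exactness at `U(A)` the corrections come from `V(A)`, because `V(A) ⟶ V(B)` is a
regular epimorphism. For exactness at `ΔV(B)` they come from `V₁(pf)`, because `V₁(pf) ⟶ V₁f` is one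
(`isRegularEpi_V₁map`).

Barr exactness makes `V(R[f])` the kernel pair of its coequalizer, so `V₁f` consists of the elements
related to zero by `V(R[f])`. Both the last fact and the normality of `V₁f` in `K` rest on this
description. The left end is formal: `ΔV(A)` is the kernel of `α_A`, so `K[γ]` and the kernel of
`ΔVf` are the same intersection inside `DV(A)`. -/

lemma exists_comp_eq_of_regularEpi {T T' A W : C} {e : T' ⟶ T} (he : IsRegularEpi e) (m : W ⟶ A)
    [Mono m] {x : T ⟶ A} {y : T' ⟶ W} (w : y ≫ m = e ≫ x) : ∃ z : T ⟶ W, z ≫ m = x := by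
  have sq : CommSq y e m x := ⟨w⟩
  exact ⟨sq.lift, sq.fac_right⟩

lemma IsZeroHom.of_regularEpi_comp [QuasiPointed C] {T T' A : C} {e : T' ⟶ T}
    (he : IsRegularEpi e) {x : T ⟶ A} (h : IsZeroHom (e ≫ x)) : IsZeroHom x := by
  have := mono_initial_to A
  obtain ⟨t, ht⟩ := h
  obtain ⟨z, hz⟩ := exists_comp_eq_of_regularEpi he (initial.to A) ht.symm
  exact ⟨z, hz.symm⟩

lemma isRegularEpi_comp [Regular C] {A B D : C} {f : A ⟶ B} {g : B ⟶ D} (hf : IsRegularEpi f)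
    (hg : IsRegularEpi g) : IsRegularEpi (f ≫ g) := by
  have : StrongEpi (f ≫ g) := strongEpi_comp f g
  infer_instance

lemma isRegularEpi_of_comp [Regular C] {A B D : C} {f : A ⟶ B} {g : B ⟶ D} {h : A ⟶ D}
    (hh : IsRegularEpi h) (w : f ≫ g = h) : IsRegularEpi g := by
  subst w
  have : StrongEpi g := strongEpi_of_strongEpi f g
  infer_instance

lemma exists_cover [Regular C] {A B T : C} {e : A ⟶ B} (he : IsRegularEpi e) (x : T ⟶ B) :
    ∃ (T' : C) (c : T' ⟶ T) (y : T' ⟶ A), IsRegularEpi c ∧ y ≫ e = c ≫ x :=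
  ⟨_, pullback.snd e x, pullback.fst e x, inferInstance, pullback.condition⟩

/-- Exactness may be tested on generalized elements, locally for the regular topology. -/
lemma exactAt_of_cover [QuasiPointed C] [Regular C] {X A Y : C} {f : X ⟶ A} {g : A ⟶ Y}
    (hz : IsZeroHom (f ≫ g))
    (h : ∀ {T : C} (x : T ⟶ A), IsZeroHom (x ≫ g) →
      ∃ (T' : C) (c : T' ⟶ T) (y : T' ⟶ X), IsRegularEpi c ∧ y ≫ f = c ≫ x) : ExactAt f g := by
  let F := Regular.strongEpiMonoFactorisation f
  have hm : Mono F.m := F.m_mono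
  have hfac : F.e ≫ F.m = f := F.fac
  have he : IsRegularEpi F.e := inferInstance
  refine ⟨F.I, F.e, F.m, he, hfac, IsKer.mk' ?_ ?_⟩
  · refine IsZeroHom.of_regularEpi_comp he ?_
    rwa [← Category.assoc, hfac]
  · intro T x hx
    obtain ⟨T', c, y, hc, hy⟩ := h x hx
    refine exists_comp_eq_of_regularEpi hc F.m (y := y ≫ F.e) ?_
    rw [Category.assoc, hfac, hy]

end Covers

/-! ### Kernels and cokernels -/

section Kernels

/-- A cokernel of `k` is a coequalizer of `k` and the zero arrow through `0`. -/
lemma IsCoker.isRegularEpi [QuasiPointed C] {K A Q : C} {k : K ⟶ A} {q : A ⟶ Q}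
    (h : IsCoker q k) : IsRegularEpi q := by
  have := h.epi
  have hd := @IsCoker.exists_desc _ _ _ _ _ _ _ _ h
  obtain ⟨t, ht⟩ := h
  have w : k ≫ q = (t ≫ initial.to A) ≫ q := by rw [ht.w]; simp
  have hs (s : Cofork k (t ≫ initial.to A)) : IsZeroHom (k ≫ s.π) :=
    ⟨t, by rw [s.condition]; simp⟩
  exact ⟨⟨⟨K, k, t ≫ initial.to A, w, Cofork.IsColimit.mk _ (fun s => (hd s.π (hs s)).choose)
    (fun s => (hd s.π (hs s)).choose_spec) (fun s m hm => by
      rw [← cancel_epi q]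
      exact hm.trans (hd s.π (hs s)).choose_spec.symm)⟩⟩⟩

/-- A kernel is a kernel of its cokernel. -/
lemma IsKer.of_isCoker [QuasiPointed C] {K A B Q : C} {k : K ⟶ A} {g : A ⟶ B} {q : A ⟶ Q}
    (hk : IsKer k g) (hq : IsCoker q k) : IsKer k q := by
  have := hk.mono
  obtain ⟨d, rfl⟩ := hq.exists_desc g hk.zero
  refine IsKer.mk' hq.zero fun x hx => hk.exists_lift x ?_
  rw [← Category.assoc]
  exact hx.comp_right d

lemma Quot.isKer [Sequentiable C] {K A : C} (k : K ⟶ A) (hk : IsNormal k) :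
    IsKer k (Quot.π k hk) := by
  obtain ⟨B, g, hg⟩ := hk
  exact hg.of_isCoker (Quot.isCoker k _)

lemma Quot.isRegularEpi [Sequentiable C] {K A : C} (k : K ⟶ A) (hk : IsNormal k) :
    IsRegularEpi (Quot.π k hk) :=
  (Quot.isCoker k hk).isRegularEpi

variable [Sequentiable C]

/-- If `j` maps to `X` by a regular epimorphism and is killed by `h`, then a subobject that
contains the image of `ker g` under `h` contains the whole image of `h`. -/
lemma exists_comp_eq_of_ker {L N X Y J W : C} {k : L ⟶ N} {g : N ⟶ X} (hk : IsKer k g)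
    (h : N ⟶ Y) (j : J ⟶ N) (hg : IsRegularEpi (j ≫ g)) (hj : IsZeroHom (j ≫ h)) (m : W ⟶ Y)
    [Mono m] (w : L ⟶ W) (hw : w ≫ m = k ≫ h) : ∃ z : N ⟶ W, z ≫ m = h := by
  -- The section `s` splits `p₁`, and `p₂` carries the kernel of `p₁` into that of `g`. This brings
  -- the situation into the form required by `isIso_of_point`.
  let p₁ := pullback.fst (j ≫ g) g
  let p₂ := pullback.snd (j ≫ g) g
  have hp₂ : IsRegularEpi p₂ := inferInstanceAs (IsRegularEpi (pullback.snd _ _))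
  let s : J ⟶ pullback (j ≫ g) g := pullback.lift (𝟙 J) j (by simp)
  have hs₁ : s ≫ p₁ = 𝟙 J := pullback.lift_fst _ _ _
  have hs₂ : s ≫ p₂ = j := pullback.lift_snd _ _ _
  obtain ⟨l, hl⟩ := hk.exists_lift (ker p₁ ≫ p₂) (by
    rw [Category.assoc, ← show p₁ ≫ j ≫ g = p₂ ≫ g from pullback.condition, ← Category.assoc]
    exact (isKer_ker p₁).zero.comp_right _)
  obtain ⟨t, ht⟩ := isKer_ker p₁
  obtain ⟨r, hr⟩ := hj
  -- `n` is the subobject of the pullback on which `p₂ ≫ h` takes values in `W`. It contains the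
  -- kernel of `p₁` (by `w`) and the section `s` (as `h` kills `j`), so it is everything.
  let n := pullback.fst (p₂ ≫ h) m
  have : IsIso n := isIso_of_point hs₁ ht n
    (pullback.lift (ker p₁) (l ≫ w) (by
      rw [Category.assoc, hw, ← Category.assoc, ← Category.assoc, hl]))
    (pullback.lift_fst _ _ _)
    (pullback.lift s (r ≫ initial.to W) (by
      rw [← Category.assoc, hs₂, hr]
      simp))
    (pullback.lift_fst _ _ _)
  refine exists_comp_eq_of_regularEpi hp₂ m (y := inv n ≫ pullback.snd (p₂ ≫ h) m) ?_
  rw [Category.assoc, ← pullback.condition, IsIso.inv_hom_id_assoc]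

/-- The substitute for subtracting from an element of `N` an element of `J` with the same image in
`X`. It is `exists_comp_eq_of_ker` with `W` the image of `k ≫ h`. -/
lemma exists_cover_ker {L N X Y J : C} {k : L ⟶ N} {g : N ⟶ X} (hk : IsKer k g)
    (h : N ⟶ Y) (j : J ⟶ N) (hg : IsRegularEpi (j ≫ g)) (hj : IsZeroHom (j ≫ h)) {T : C}
    (x : T ⟶ N) :
    ∃ (T' : C) (c : T' ⟶ T) (y : T' ⟶ L), IsRegularEpi c ∧ y ≫ k ≫ h = c ≫ x ≫ h := by
  let F := Regular.strongEpiMonoFactorisation (k ≫ h)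
  have hm : Mono F.m := F.m_mono
  have hfac : F.e ≫ F.m = k ≫ h := F.fac
  have he : IsRegularEpi F.e := inferInstance
  obtain ⟨z, hz⟩ := exists_comp_eq_of_ker hk h j hg hj F.m F.e hfac
  obtain ⟨T', c, y, hc, hy⟩ := exists_cover he (x ≫ z)
  refine ⟨T', c, y, hc, ?_⟩
  rw [← hfac, ← Category.assoc, hy, Category.assoc, Category.assoc, hz]

end Kernels

/-- A regular epimorphism of split epimorphisms is locally surjective on kernels. -/
lemma exists_cover_ker_of_split [Sequentiable C] {E E' B B' T : C} {p : E ⟶ B} {s : B ⟶ E}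
    (hs : s ≫ p = 𝟙 B) {p' : E' ⟶ B'} {s' : B' ⟶ E'} {ε : E ⟶ E'} (hε : IsRegularEpi ε)
    {β : B ⟶ B'} (hp : ε ≫ p' = p ≫ β) (hsε : s ≫ ε = β ≫ s') (x : T ⟶ E')
    (hx : IsZeroHom (x ≫ p')) :
    ∃ (T' : C) (c : T' ⟶ T) (y : T' ⟶ E), IsRegularEpi c ∧ IsZeroHom (y ≫ p) ∧
      y ≫ ε = c ≫ x := by
  obtain ⟨T₁, c₁, y₁, hc₁, hy₁⟩ := exists_cover hε x
  -- The lift `y₁` of `x` is killed only by `p ≫ β`. The restriction of `s` to the kernel of `β`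
  -- supplies the corrections: it splits the restriction `g` of `p`, and `ε` kills it since `s ≫ ε =
  -- β ≫ s'`.
  obtain ⟨n, hn⟩ := (isKer_ker (p ≫ β)).exists_lift y₁ (by
    rw [← hp, ← Category.assoc, hy₁, Category.assoc]
    exact hx.comp_left c₁)
  obtain ⟨g, hg⟩ := (isKer_ker β).exists_lift (ker (p ≫ β) ≫ p) (by
    rw [Category.assoc]
    exact (isKer_ker _).zero)
  obtain ⟨j, hj⟩ := (isKer_ker (p ≫ β)).exists_lift (ker β ≫ s) (by
    rw [Category.assoc, ← Category.assoc s, hs, Category.id_comp]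
    exact (isKer_ker _).zero)
  have hjg : j ≫ g = 𝟙 _ := by
    rw [← cancel_mono (ker β), Category.assoc, hg, ← Category.assoc, hj, Category.assoc, hs]
    simp
  obtain ⟨T₂, c₂, y₂, hc₂, hy₂⟩ := exists_cover_ker (isKer_ker g) (ker (p ≫ β) ≫ ε) j
    (by rw [hjg]; infer_instance) (by
      rw [← Category.assoc, hj, Category.assoc, hsε, ← Category.assoc]
      exact (isKer_ker β).zero.comp_right s') n
  refine ⟨T₂, c₂ ≫ c₁, y₂ ≫ ker g ≫ ker (p ≫ β), isRegularEpi_comp hc₂ hc₁, ?_, ?_⟩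
  · rw [Category.assoc, Category.assoc, ← hg, ← Category.assoc (ker g)]
    exact ((isKer_ker g).zero.comp_right _).comp_left _
  · rw [Category.assoc, Category.assoc, hy₂, ← Category.assoc n, hn, hy₁, Category.assoc]

namespace BirkhoffSubfunctor

/-! ### Right exactness of the reflector `U` -/

section Reflector

variable [Sequentiable C] (V : BirkhoffSubfunctor C)

lemma isKer_incl (A : C) : IsKer (V.incl A) (V.η A) := Quot.isKer _ _

lemma isRegularEpi_η (A : C) : IsRegularEpi (V.η A) := Quot.isRegularEpi _ _

lemma η_naturality {A B : C} (f : A ⟶ B) : V.η A ≫ V.U.map f = f ≫ V.η B :=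
  Quot.π_map _ (V.normal_incl A) _ (V.normal_incl B) (V.V.map f) f (V.incl_naturality f).symm

/-- The reflector `U` preserves regular epimorphisms. -/
lemma isRegularEpi_U_map {A B : C} {f : A ⟶ B} (hf : IsRegularEpi f) :
    IsRegularEpi (V.U.map f) :=
  isRegularEpi_of_comp (isRegularEpi_comp hf (V.isRegularEpi_η B)) (V.η_naturality f)

/-- An element of `U(A)` killed by `Uf` lifts locally to an element of `A` with image in `V(B)`.
Since `Vf` is a regular epimorphism, it can be corrected by `V(A)`, which `η_A` kills, to an element
of `K`. -/
lemma exactAt_U {K A B : C} {k : K ⟶ A} {f : A ⟶ B} (h : IsKer k f) (hf : IsRegularEpi f) :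
    ExactAt (k ≫ V.η A) (V.U.map f) := by
  refine exactAt_of_cover ?_ fun {T} u hu => ?_
  · rw [Category.assoc, η_naturality, ← Category.assoc]
    exact h.zero.comp_right _
  · obtain ⟨T₁, c₁, a, hc₁, ha⟩ := exists_cover (V.isRegularEpi_η A) u
    obtain ⟨b, hb⟩ := (V.isKer_incl B).exists_lift (a ≫ f) (by
      rw [Category.assoc, ← η_naturality, ← Category.assoc, ha, Category.assoc]
      exact hu.comp_left c₁)
    -- `exists_cover_ker` is applied to the preimage of `V(B)` in `A`: the projection `g` to `V(B)`
    -- has kernel `K`, and `V(A)` maps to the preimage by `j`.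
    let n := pullback.fst f (V.incl B)
    let g := pullback.snd f (V.incl B)
    have hng : n ≫ f = g ≫ V.incl B := pullback.condition
    obtain ⟨t, ht⟩ := h.zero
    let k' : K ⟶ pullback f (V.incl B) := pullback.lift k (t ≫ initial.to _) (by rw [ht]; simp)
    have hk'n : k' ≫ n = k := pullback.lift_fst _ _ _
    have hk'g : k' ≫ g = t ≫ initial.to _ := pullback.lift_snd _ _ _
    have hk' : IsKer k' g := by
      have := h.mono
      have : Mono (k' ≫ n) := by rwa [hk'n]
      have : Mono k' := mono_of_mono k' n
      refine IsKer.mk' ⟨t, hk'g⟩ fun x hx => ?_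
      obtain ⟨y, hy⟩ := h.exists_lift (x ≫ n) (by
        rw [Category.assoc, hng, ← Category.assoc]
        exact hx.comp_right _)
      refine ⟨y, ?_⟩
      rw [← cancel_mono n, Category.assoc, hk'n, hy]
    let j : V.V.obj A ⟶ pullback f (V.incl B) :=
      pullback.lift (V.incl A) (V.V.map f) (V.incl_naturality f).symm
    have hjn : j ≫ n = V.incl A := pullback.lift_fst _ _ _
    have hjg : j ≫ g = V.V.map f := pullback.lift_snd _ _ _
    obtain ⟨T₂, c₂, y, hc₂, hy⟩ := exists_cover_ker hk' (n ≫ V.η A) j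
      (by rw [hjg]; exact V.map_regularEpi f hf)
      (by rw [← Category.assoc, hjn]; exact (V.isKer_incl A).zero) (pullback.lift a b hb.symm)
    refine ⟨T₂, c₂ ≫ c₁, y, isRegularEpi_comp hc₂ hc₁, ?_⟩
    have hn : pullback.lift a b hb.symm ≫ n = a := pullback.lift_fst _ _ _
    rw [← hk'n, Category.assoc, hy, ← Category.assoc (pullback.lift a b _), hn, ha,
      Category.assoc]

end Reflector

/-! ### The object `V₁` through kernel pairs -/

section V₁

variable [BarrExact C] [Sequentiable C] (V : BirkhoffSubfunctor C)

/-- The image under `V` of the kernel pair of `p` is the kernel pair of its coequalizer. -/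
lemma isKernelPair_coeq {A₀ A : C} (p : A₀ ⟶ A) :
    IsKernelPair (V.coeq p) (V.V.map (pullback.fst p p)) (V.V.map (pullback.snd p p)) := by
  let d : A₀ ⟶ pullback p p := pullback.lift (𝟙 A₀) (𝟙 A₀) rfl
  let s : pullback p p ⟶ pullback p p :=
    pullback.lift (pullback.snd p p) (pullback.fst p p) pullback.condition.symm
  have hmono : JointlyMono₂ (V.V.map (pullback.fst p p)) (V.V.map (pullback.snd p p)) := by
    refine ⟨fun Y f g h₁ h₂ => ?_⟩
    rw [← cancel_mono (V.incl _)]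
    apply pullback.hom_ext
    · rw [Category.assoc, Category.assoc, ← V.incl_naturality, ← Category.assoc, h₁,
        Category.assoc]
    · rw [Category.assoc, Category.assoc, ← V.incl_naturality, ← Category.assoc, h₂,
        Category.assoc]
  have hd₀ : V.V.map d ≫ V.V.map (pullback.fst p p) = 𝟙 _ := by
    rw [← V.V.map_comp, pullback.lift_fst, V.V.map_id]
  have hd₁ : V.V.map d ≫ V.V.map (pullback.snd p p) = 𝟙 _ := by
    rw [← V.V.map_comp, pullback.lift_snd, V.V.map_id]
  obtain ⟨t, ht₀, ht₁⟩ := exists_transitivity hmono (V.V.map d) hd₀ hd₁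
  have hE : IsEquivalenceRelation (V.V.map (pullback.fst p p)) (V.V.map (pullback.snd p p)) :=
    ⟨⟨{ right_cancellation := hmono.right_cancellation
        r := V.V.map d
        reflexivity₁ := hd₀
        reflexivity₂ := hd₁
        s := V.V.map s
        symmetry₁ := by rw [← V.V.map_comp]; exact congrArg V.V.map (pullback.lift_fst _ _ _)
        symmetry₂ := by rw [← V.V.map_comp]; exact congrArg V.V.map (pullback.lift_snd _ _ _)
        c := _
        isLimit := pullbackIsPullback _ _
        t := t
        transitivity₁ := ht₀
        transitivity₂ := ht₁ }⟩⟩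
  -- Exactness gives some `f` with this kernel pair. It factors through the coequalizer, which
  -- therefore has the same kernel pair.
  obtain ⟨B, f, hf⟩ := BarrExact.exists_isKernelPair _ _ hE
  have hfac : V.coeq p ≫ coequalizer.desc f hf.w = f := coequalizer.π_desc _ _
  rw [← hfac] at hf
  exact hf.cancel_right (coequalizer.condition _ _)

/-- Generalized elements of `V₁p` are the elements that are related to zero by the image under `V`
of the kernel pair of `p`. -/
lemma isZeroHom_comp_coeq_iff {T A₀ A : C} (p : A₀ ⟶ A) (x : T ⟶ V.V.obj A₀) :
    IsZeroHom (x ≫ V.coeq p) ↔ ∃ r : T ⟶ V.V.obj (pullback p p),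
      IsZeroHom (r ≫ V.V.map (pullback.fst p p)) ∧ r ≫ V.V.map (pullback.snd p p) = x := by
  constructor
  · rintro ⟨t, ht⟩
    have w : (t ≫ initial.to (V.V.obj A₀)) ≫ V.coeq p = x ≫ V.coeq p := by rw [ht]; simp
    exact ⟨(V.isKernelPair_coeq p).lift _ _ w, ⟨t, IsKernelPair.lift_fst _ _ _ w⟩,
      IsKernelPair.lift_snd _ _ _ w⟩
  · rintro ⟨r, hr, rfl⟩
    rw [Category.assoc, ← (V.isKernelPair_coeq p).w, ← Category.assoc]
    exact hr.comp_right _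

/-- `V` preserves the regular epimorphism `ρ : R[pf] ⟶ R[f]`. Elements of `V₁` are the second
components of elements of `V(R[-])` with first component zero, and the first projections are split
by the diagonals, so `exists_cover_ker_of_split` lifts such elements along `V(ρ)`. -/
lemma isRegularEpi_V₁map {A₀ A B : C} {p : A₀ ⟶ A} (hp : IsRegularEpi p) (f : A ⟶ B)
    (w : p ≫ f = (p ≫ f) ≫ 𝟙 B) : IsRegularEpi (V.V₁map p (𝟙 B) w) := by
  let ρ : pullback (p ≫ f) (p ≫ f) ⟶ pullback f f :=
    pullback.lift (pullback.fst _ _ ≫ p) (pullback.snd _ _ ≫ p) (by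
      simpa using pullback.condition)
  have hρ₀ : ρ ≫ pullback.fst f f = pullback.fst _ _ ≫ p := pullback.lift_fst _ _ _
  have hρ₁ : ρ ≫ pullback.snd f f = pullback.snd _ _ ≫ p := pullback.lift_snd _ _ _
  -- The two components of the generic element of `R[f]` are lifted along `p` one after the other,
  -- each on a cover.
  have hρ : IsRegularEpi ρ := by
    obtain ⟨T₁, c₁, y₁, hc₁, hy₁⟩ := exists_cover hp (pullback.fst f f)
    obtain ⟨T₂, c₂, y₂, hc₂, hy₂⟩ := exists_cover hp (c₁ ≫ pullback.snd f f)
    refine isRegularEpi_of_comp (isRegularEpi_comp hc₂ hc₁)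
      (f := pullback.lift (c₂ ≫ y₁) y₂ ?_) ?_
    · rw [Category.assoc, ← Category.assoc y₁, hy₁, ← Category.assoc y₂, hy₂]
      simp [pullback.condition]
    · apply pullback.hom_ext
      · rw [Category.assoc, hρ₀, pullback.lift_fst_assoc, Category.assoc, hy₁, Category.assoc]
      · rw [Category.assoc, hρ₁, pullback.lift_snd_assoc, hy₂, Category.assoc]
  -- `r` is the generic element of `V₁f`, seen in `V(R[f])`.
  obtain ⟨r, hr₀, hr₁⟩ := (V.isZeroHom_comp_coeq_iff f (V.V₁ι f)).1 (V.isKer_V₁ι f).zero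
  let d : A₀ ⟶ pullback (p ≫ f) (p ≫ f) := pullback.lift (𝟙 _) (𝟙 _) rfl
  let d' : A ⟶ pullback f f := pullback.lift (𝟙 _) (𝟙 _) rfl
  have hd : d ≫ ρ = p ≫ d' := by
    apply pullback.hom_ext
    · rw [Category.assoc, hρ₀, pullback.lift_fst_assoc, Category.assoc, pullback.lift_fst]
      simp
    · rw [Category.assoc, hρ₁, pullback.lift_snd_assoc, Category.assoc, pullback.lift_snd]
      simp
  obtain ⟨T, c, y, hc, hy₀, hy⟩ := exists_cover_ker_of_split
    (p := V.V.map (pullback.fst (p ≫ f) (p ≫ f))) (s := V.V.map d)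
    (by rw [← V.V.map_comp, pullback.lift_fst, V.V.map_id])
    (p' := V.V.map (pullback.fst f f)) (s' := V.V.map d') (V.map_regularEpi ρ hρ)
    (β := V.V.map p)
    (by rw [← V.V.map_comp, ← V.V.map_comp, hρ₀]) (by rw [← V.V.map_comp, ← V.V.map_comp, hd])
    r hr₀
  obtain ⟨z, hz⟩ := (V.isKer_V₁ι (p ≫ f)).exists_lift (y ≫ V.V.map (pullback.snd _ _))
    ((V.isZeroHom_comp_coeq_iff _ _).2 ⟨y, hy₀, rfl⟩)
  refine isRegularEpi_of_comp hc (f := z) ?_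
  rw [← cancel_mono (V.V₁ι f), Category.assoc, V₁map_ι, ← Category.assoc, hz, Category.assoc,
    ← V.V.map_comp, ← hρ₁, V.V.map_comp, ← Category.assoc, hy, Category.assoc, hr₁]

lemma V₁toK_k (S : SES C) : V.V₁toK S ≫ S.k = V.V₁ι S.f ≫ V.incl S.A :=
  S.shortExact.1.lift_comp _ _

/-- Let `j = (0, k) : K ⟶ R[f]`. Then `V₁f` is the preimage under `j` of the kernel `V(R[f]) ⟶
R[f]`, hence a kernel of `j` followed by `η`. -/
lemma normal_V₁toK (S : SES C) : IsNormal (V.V₁toK S) := by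
  have hk := S.shortExact.1.mono
  obtain ⟨t, ht⟩ := S.shortExact.1.zero
  let j : S.K ⟶ pullback S.f S.f := pullback.lift (t ≫ initial.to S.A) S.k (by rw [ht]; simp)
  have hj₀ : j ≫ pullback.fst S.f S.f = t ≫ initial.to S.A := pullback.lift_fst _ _ _
  have hj₁ : j ≫ pullback.snd S.f S.f = S.k := pullback.lift_snd _ _ _
  have hm : Mono (V.V₁toK S) := by
    have : Mono (V.V₁toK S ≫ S.k) := by
      rw [V₁toK_k]
      infer_instance
    exact mono_of_mono _ S.k
  refine ⟨_, j ≫ V.η _, IsKer.mk' ?_ fun {T} x hx => ?_⟩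
  · obtain ⟨r, hr₀, hr₁⟩ :=
      (V.isZeroHom_comp_coeq_iff S.f (V.V₁ι S.f)).1 (V.isKer_V₁ι S.f).zero
    have h : V.V₁toK S ≫ j = r ≫ V.incl _ := by
      apply pullback.hom_ext
      · rw [Category.assoc, hj₀, Category.assoc, ← incl_naturality, ← Category.assoc r]
        exact IsZeroHom.eq ⟨V.V₁toK S ≫ t, by simp⟩ (hr₀.comp_right _)
      · rw [Category.assoc, hj₁, V₁toK_k, Category.assoc, ← incl_naturality, ← hr₁,
          Category.assoc]
    rw [← Category.assoc, h, Category.assoc]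
    exact (V.isKer_incl _).zero.comp_left r
  · obtain ⟨r, hr⟩ := (V.isKer_incl _).exists_lift (x ≫ j) (by rwa [Category.assoc])
    obtain ⟨z, hz⟩ := (V.isKer_V₁ι S.f).exists_lift (r ≫ V.V.map (pullback.snd S.f S.f))
      ((V.isZeroHom_comp_coeq_iff _ _).2 ⟨r, IsZeroHom.of_comp_mono (V.incl _) (by
        rw [Category.assoc, incl_naturality, ← Category.assoc, hr, Category.assoc, hj₀]
        exact ⟨x ≫ t, by simp⟩), rfl⟩)
    refine ⟨z, ?_⟩
    rw [← cancel_mono S.k, Category.assoc, V₁toK_k, ← Category.assoc, hz, Category.assoc,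
      incl_naturality, ← Category.assoc, hr, Category.assoc, hj₁]

end V₁

/-! ### Independence of `ΔV` from the presentation -/

section Delta

variable [BarrExact C] [Sequentiable C] (V : BirkhoffSubfunctor C) (c : ProjectiveChoice C)

lemma isRegularEpi_Dπ (A : C) : IsRegularEpi (V.Dπ c A) :=
  Quot.isRegularEpi (V.V₁ι (c.π A)) (V.normal_V₁ι _)

lemma isRegularEpi_Δπ (A : C) : IsRegularEpi (V.Δπ c A) :=
  Quot.isRegularEpi (V.V₁toKV (c.π A)) (V.normal_V₁toKV _)

/-- An element of `DV(A)` lifts locally to `V(A₀)`. If `α` kills it, then `p` kills the lift, which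
thus lies in `K[p] ∩ V(A₀)`. -/
lemma isKer_Δι (A : C) : IsKer (V.Δι c A) (V.α c A) := by
  refine IsKer.mk' ?_ fun {T} x hx => ?_
  · refine IsZeroHom.of_regularEpi_comp (V.isRegularEpi_Δπ c A) ?_
    rw [← Category.assoc, Δπ_ι, Category.assoc, Dπ_α]
    exact V.zero_KVι _
  · obtain ⟨T', e, y, he, hy⟩ := exists_cover (V.isRegularEpi_Dπ c A) x
    refine exists_comp_eq_of_regularEpi he (V.Δι c A) (y := V.KVlift (c.π A) y ?_ ≫ V.Δπ c A) ?_
    · rw [← Dπ_α, ← Category.assoc, hy, Category.assoc]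
      exact hx.comp_left e
    · rw [Category.assoc, Δπ_ι, ← Category.assoc, KVlift_ι, hy]

variable {c} {A₀ B : C} {g : A₀ ⟶ B} {t : A₀ ⟶ c.obj B}

/-- The comparison of `K[g] ∩ V(A₀)` with `ΔV(B)`, for an arrow `t` from `g : A₀ ⟶ B` to the
chosen presentation of `B`. -/
def toΔ (w : t ≫ c.π B = g) : V.KV g ⟶ V.Δobj c B :=
  V.KVmap t (𝟙 B) (by simp [w]) ≫ V.Δπ c B

lemma toΔ_ι (w : t ≫ c.π B = g) : V.toΔ w ≫ V.Δι c B = V.KVι g ≫ V.V.map t ≫ V.Dπ c B := by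
  rw [toΔ, Category.assoc, Δπ_ι, ← Category.assoc, KVmap_ι, Category.assoc]

/-- Projectivity gives an arrow `s` back from the chosen presentation. The composite `s ≫ t` and the
identity agree over `B`, so they induce the same arrow to `DV(B)`, and `Δπ` factors through `toΔ`.
-/
lemma isRegularEpi_toΔ (w : t ≫ c.π B = g) (hg : IsRegularEpi g) : IsRegularEpi (V.toΔ w) := by
  obtain ⟨s, hs⟩ := c.projective B g hg (c.π B)
  refine isRegularEpi_of_comp (V.isRegularEpi_Δπ c B)
    (f := V.KVmap s (𝟙 B) (by simp [hs])) ?_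
  rw [← cancel_mono (V.Δι c B), Category.assoc, toΔ_ι, ← Category.assoc, KVmap_ι, Δπ_ι,
    Category.assoc, ← Category.assoc (V.V.map s), ← V.V.map_comp]
  congr 1
  refine (V.map_comp_DVπ (p := c.π B) (g := 𝟙 _) ?_).trans ?_
  · rw [Category.assoc, w, hs, Category.id_comp]
  · rw [V.V.map_id, Category.id_comp]
    rfl

/-- Here the other composite `t ≫ s` counts: it agrees with the identity over `B`. An element killed
in `ΔV(B)` is sent by `V(t)` into `V₁` of the chosen presentation, then by `V(s)` into `V₁g`; modulo
`V₁g` it has not changed. -/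
lemma isKer_V₁toKV_toΔ (w : t ≫ c.π B = g) (hg : IsRegularEpi g) :
    IsKer (V.V₁toKV g) (V.toΔ w) := by
  have := (V.isKer_V₁toKV g).mono
  obtain ⟨s, hs⟩ := c.projective B g hg (c.π B)
  refine IsKer.mk' ?_ fun {T} x hx => ?_
  · refine IsZeroHom.of_comp_mono (V.Δι c B) ?_
    rw [Category.assoc, toΔ_ι, ← Category.assoc, V₁toKV_ι, ← Category.assoc,
      ← V.V₁map_ι (q := c.π B) t (𝟙 B) (by simp [w]), Category.assoc]
    exact (V.isKer_DVπ (c.π B)).zero.comp_left _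
  · obtain ⟨y, hy⟩ := (V.isKer_DVπ (c.π B)).exists_lift (x ≫ V.KVι g ≫ V.V.map t) (by
      have := hx.comp_right (V.Δι c B)
      rw [Category.assoc, toΔ_ι] at this
      rw [Category.assoc, Category.assoc]
      exact this)
    refine (V.isKer_V₁toKV g).exists_lift x ?_
    have h : V.V.map t ≫ V.V.map s ≫ V.DVπ g = V.DVπ g := by
      rw [← Category.assoc, ← V.V.map_comp]
      refine (V.map_comp_DVπ (p := g) (g := 𝟙 _) ?_).trans ?_
      · rw [Category.assoc, hs, w, Category.id_comp]
      · rw [V.V.map_id, Category.id_comp]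
    have h' : x ≫ V.KVι g ≫ V.DVπ g = y ≫ V.V₁map s (𝟙 B) (by simp [hs]) ≫ V.V₁ι g ≫ V.DVπ g := by
      rw [← Category.assoc (V.V₁map _ _ _), V₁map_ι, Category.assoc, ← Category.assoc y, hy,
        Category.assoc, Category.assoc, h]
    rw [h']
    exact ((V.isKer_DVπ g).zero.comp_left _).comp_left _

end Delta

end BirkhoffSubfunctor

lemma SES.isRegularEpi [QuasiPointed C] (S : SES C) : IsRegularEpi S.f :=
  S.shortExact.2.isRegularEpi

namespace BirkhoffSubfunctor

/-! ### The object `K[pf] ∩ V(A₀)` over `K` -/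

section Intersection

variable [Sequentiable C] (V : BirkhoffSubfunctor C) (c : ProjectiveChoice C)

/-- The arrow `K[pf] ∩ V(A₀) ⟶ K` induced by `p`. -/
def KVtoK (S : SES C) : V.KV (c.π S.A ≫ S.f) ⟶ S.K :=
  S.shortExact.1.lift (V.KVι _ ≫ V.incl _ ≫ c.π S.A) (by
    simpa using V.zero_KVι (c.π S.A ≫ S.f))

lemma KVtoK_k (S : SES C) : V.KVtoK c S ≫ S.k = V.KVι _ ≫ V.incl _ ≫ c.π S.A :=
  S.shortExact.1.lift_comp _ _

/-- The inclusion of `K[p] ∩ V(A₀)` into `K[pf] ∩ V(A₀)`. -/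
def KVincl (S : SES C) : V.KV (c.π S.A) ⟶ V.KV (c.π S.A ≫ S.f) :=
  V.KVmap (𝟙 _) S.f (by simp)

lemma KVincl_ι (S : SES C) : V.KVincl c S ≫ V.KVι _ = V.KVι _ := by
  rw [KVincl, KVmap_ι]
  simp

lemma isKer_KVincl (S : SES C) : IsKer (V.KVincl c S) (V.KVtoK c S) := by
  have hk := S.shortExact.1.mono
  have : Mono (V.KVincl c S) := by
    have : Mono (V.KVincl c S ≫ V.KVι _) := by
      rw [KVincl_ι]
      infer_instance
    exact mono_of_mono _ (V.KVι _)
  refine IsKer.mk' (IsZeroHom.of_comp_mono S.k ?_) fun {T} x hx => ?_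
  · rw [Category.assoc, KVtoK_k, ← Category.assoc, KVincl_ι]
    exact V.zero_KVι _
  · refine ⟨V.KVlift _ (x ≫ V.KVι _) ?_, ?_⟩
    · rw [Category.assoc, ← KVtoK_k, ← Category.assoc]
      exact hx.comp_right _
    · rw [← cancel_mono (V.KVι _), Category.assoc, KVincl_ι, KVlift_ι]

end Intersection

variable [BarrExact C] [Sequentiable C] (V : BirkhoffSubfunctor C) (c : ProjectiveChoice C)

/-! ### The arrow `K[γ] ⟶ ΔV(A)` -/

/-- The arrow `K[γ] ⟶ ΔV(A)`. -/
def KγtoΔ (S : SES C) : Ker (V.γ c S) ⟶ V.Δobj c S.A :=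
  (V.isKer_Δι c S.A).lift (ker (V.γ c S) ≫ ker ((V.D c).map S.f)) (by
    rw [Category.assoc, ← γ_k, ← Category.assoc]
    exact (isKer_ker _).zero.comp_right _)

lemma KγtoΔ_ι (S : SES C) :
    V.KγtoΔ c S ≫ V.Δι c S.A = ker (V.γ c S) ≫ ker ((V.D c).map S.f) :=
  (V.isKer_Δι c S.A).lift_comp _ _

instance (S : SES C) : Mono (V.KγtoΔ c S) := by
  have : Mono (V.KγtoΔ c S ≫ V.Δι c S.A) := by
    rw [KγtoΔ_ι]
    infer_instance
  exact mono_of_mono _ (V.Δι c S.A)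

lemma KγtoΔ_naturality {S T : SES C} (φ : S ⟶ T) :
    V.Kγmap c φ ≫ V.KγtoΔ c T = V.KγtoΔ c S ≫ V.Δmap c φ.a := by
  rw [← cancel_mono (V.Δι c T.A), Category.assoc, KγtoΔ_ι, Kγmap_ker, Category.assoc,
    Category.assoc, Δmap_ι, ← Category.assoc (V.KγtoΔ c S), KγtoΔ_ι, Category.assoc]

/-- Inside `DV(A)` both subobjects consist of the elements killed by `α_A` and by `DVf`. -/
lemma isKer_KγtoΔ (S : SES C) : IsKer (V.KγtoΔ c S) (V.Δmap c S.f) := by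
  refine IsKer.mk' (IsZeroHom.of_comp_mono (V.Δι c S.B) ?_) fun {T} x hx => ?_
  · rw [Category.assoc, Δmap_ι, ← Category.assoc, KγtoΔ_ι, Category.assoc]
    exact (isKer_ker _).zero.comp_left _
  · obtain ⟨y, hy⟩ := (isKer_ker ((V.D c).map S.f)).exists_lift (x ≫ V.Δι c S.A) (by
      rw [Category.assoc, ← Δmap_ι, ← Category.assoc]
      exact hx.comp_right _)
    have := S.shortExact.1.mono
    obtain ⟨z, hz⟩ := (isKer_ker (V.γ c S)).exists_lift y (by
      refine IsZeroHom.of_comp_mono S.k ?_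
      rw [Category.assoc, γ_k, ← Category.assoc, hy, Category.assoc]
      exact (V.isKer_Δι c S.A).zero.comp_left x)
    exact ⟨z, by rw [← cancel_mono (V.Δι c S.A), Category.assoc, KγtoΔ_ι, ← Category.assoc, hz,
      hy]⟩

/-! ### The quotient `K/V₁f` -/

lemma V₁toK_naturality {S T : SES C} (φ : S ⟶ T) :
    V.V₁toK S ≫ φ.κ = V.V₁map φ.a φ.b φ.comm_f.symm ≫ V.V₁toK T := by
  have := T.shortExact.1.mono
  rw [← cancel_mono T.k, Category.assoc, ← φ.comm_k, ← Category.assoc, V₁toK_k, Category.assoc,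
    Category.assoc, V₁toK_k, ← Category.assoc (V.V₁map _ _ _), V₁map_ι, Category.assoc,
    incl_naturality]

/-- The functor sending a short exact sequence to `K/V₁f`. -/
def quotV₁ : SES C ⥤ C where
  obj S := Quot (V.V₁toK S) (V.normal_V₁toK S)
  map φ := Quot.map _ _ _ _ (V.V₁map φ.a φ.b φ.comm_f.symm) φ.κ (V.V₁toK_naturality φ)
  map_id S := by
    rw [← cancel_epi (Quot.π _ (V.normal_V₁toK S)), Quot.π_map]
    change 𝟙 S.K ≫ _ = _
    simp
  map_comp {S T W} φ ψ := by
    rw [← cancel_epi (Quot.π _ (V.normal_V₁toK S)), Quot.π_map]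
    refine Eq.symm ?_
    rw [← Category.assoc, Quot.π_map, Category.assoc, Quot.π_map, ← Category.assoc]
    rfl

/-- The quotient `K ⟶ K/V₁f`. -/
def quotV₁π (S : SES C) : S.K ⟶ V.quotV₁.obj S := Quot.π _ (V.normal_V₁toK S)

lemma isKer_quotV₁π (S : SES C) : IsKer (V.V₁toK S) (V.quotV₁π S) := Quot.isKer _ _

lemma isCoker_quotV₁π (S : SES C) : IsCoker (V.quotV₁π S) (V.V₁toK S) := Quot.isCoker _ _

lemma quotV₁π_naturality {S T : SES C} (φ : S ⟶ T) :
    φ.κ ≫ V.quotV₁π T = V.quotV₁π S ≫ V.quotV₁.map φ :=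
  (Quot.π_map _ _ _ _ _ _ (V.V₁toK_naturality φ)).symm

/-- The arrow `K/V₁f ⟶ U(A)`. -/
def quotV₁toU (S : SES C) : V.quotV₁.obj S ⟶ V.U.obj S.A :=
  Quot.desc _ (V.normal_V₁toK S) (S.k ≫ V.η S.A) (by
    rw [← Category.assoc, V₁toK_k, Category.assoc]
    exact (V.isKer_incl _).zero.comp_left _)

lemma quotV₁π_toU (S : SES C) : V.quotV₁π S ≫ V.quotV₁toU S = S.k ≫ V.η S.A :=
  Quot.π_desc _ _ _ _

lemma quotV₁toU_naturality {S T : SES C} (φ : S ⟶ T) :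
    V.quotV₁.map φ ≫ V.quotV₁toU T = V.quotV₁toU S ≫ V.U.map φ.a := by
  have := (V.isCoker_quotV₁π S).epi
  rw [← cancel_epi (V.quotV₁π S), ← Category.assoc, ← quotV₁π_naturality, Category.assoc,
    quotV₁π_toU, ← Category.assoc, ← φ.comm_k, ← Category.assoc (V.quotV₁π S), quotV₁π_toU,
    Category.assoc, Category.assoc, η_naturality]

/-- As `K ⟶ K/V₁f` is a regular epimorphism, the arrow `K/V₁f ⟶ U(A)` has the same image as `k ≫
η_A`, and `exactAt_U` applies. -/
lemma exactAt_U_map (S : SES C) : ExactAt (V.quotV₁toU S) (V.U.map S.f) := by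
  have hq := (V.isCoker_quotV₁π S).isRegularEpi
  obtain ⟨I, e, m, he, hem, hm⟩ := V.exactAt_U S.shortExact.1 S.isRegularEpi
  have := hm.mono
  obtain ⟨z, hz⟩ := exists_comp_eq_of_regularEpi hq m (x := V.quotV₁toU S) (y := e)
    (by rw [hem, quotV₁π_toU])
  refine ⟨I, z, m, isRegularEpi_of_comp he (f := V.quotV₁π S) ?_, hz, hm⟩
  rw [← cancel_mono m, Category.assoc, hz, quotV₁π_toU, hem]

/-! ### The connecting arrow -/

/-- The comparison of `K[pf] ∩ V(A₀)` with `ΔV(B)`, for `p : A₀ ⟶ A` the chosen presentation. -/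
def coverΔ (S : SES C) : V.KV (c.π S.A ≫ S.f) ⟶ V.Δobj c S.B := V.toΔ (c.comm S.f)

lemma coverΔ_ι (S : SES C) :
    V.coverΔ c S ≫ V.Δι c S.B = V.KVι _ ≫ V.V.map (c.map S.f) ≫ V.Dπ c S.B :=
  V.toΔ_ι _

lemma isRegularEpi_coverΔ (S : SES C) : IsRegularEpi (V.coverΔ c S) :=
  V.isRegularEpi_toΔ _ (isRegularEpi_comp (c.regularEpi _) S.isRegularEpi)

lemma isKer_coverΔ (S : SES C) : IsKer (V.V₁toKV (c.π S.A ≫ S.f)) (V.coverΔ c S) :=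
  V.isKer_V₁toKV_toΔ _ (isRegularEpi_comp (c.regularEpi _) S.isRegularEpi)

lemma isCoker_coverΔ (S : SES C) : IsCoker (V.coverΔ c S) (V.V₁toKV (c.π S.A ≫ S.f)) :=
  isCoker_of_isRegularEpi (V.isKer_coverΔ c S) (V.isRegularEpi_coverΔ c S)

/-- This makes the connecting arrow well defined, and in `exactAt_Δ` it provides the corrections. -/
lemma V₁toKV_KVtoK (S : SES C) :
    V.V₁toKV (c.π S.A ≫ S.f) ≫ V.KVtoK c S =
      V.V₁map (c.π S.A) (𝟙 S.B) (by simp) ≫ V.V₁toK S := by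
  have := S.shortExact.1.mono
  rw [← cancel_mono S.k, Category.assoc, KVtoK_k, ← Category.assoc, V₁toKV_ι, Category.assoc,
    V₁toK_k, ← Category.assoc (V.V₁map _ _ _), V₁map_ι, Category.assoc, incl_naturality]

lemma zero_V₁toKV_KVtoK (S : SES C) :
    IsZeroHom (V.V₁toKV (c.π S.A ≫ S.f) ≫ V.KVtoK c S ≫ V.quotV₁π S) := by
  rw [← Category.assoc, V₁toKV_KVtoK, Category.assoc]
  exact (V.isKer_quotV₁π S).zero.comp_left _

/-- The connecting arrow `ΔV(B) ⟶ K/V₁f`. -/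
def connecting (S : SES C) : V.Δobj c S.B ⟶ V.quotV₁.obj S :=
  ((V.isCoker_coverΔ c S).exists_desc _ (V.zero_V₁toKV_KVtoK c S)).choose

lemma coverΔ_connecting (S : SES C) :
    V.coverΔ c S ≫ V.connecting c S = V.KVtoK c S ≫ V.quotV₁π S :=
  ((V.isCoker_coverΔ c S).exists_desc _ (V.zero_V₁toKV_KVtoK c S)).choose_spec

lemma connecting_naturality {S T : SES C} (φ : S ⟶ T) :
    V.Δmap c φ.b ≫ V.connecting c T = V.connecting c S ≫ V.quotV₁.map φ := by
  have := (V.isCoker_coverΔ c S).epi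
  have hT := T.shortExact.1.mono
  have w : c.map φ.a ≫ c.π T.A ≫ T.f = (c.π S.A ≫ S.f) ≫ φ.b := by
    rw [← Category.assoc, c.comm, Category.assoc, Category.assoc, φ.comm_f]
  have h₁ : V.coverΔ c S ≫ V.Δmap c φ.b = V.KVmap (c.map φ.a) φ.b w ≫ V.coverΔ c T := by
    rw [← cancel_mono (V.Δι c T.B), Category.assoc, Δmap_ι, ← Category.assoc, coverΔ_ι,
      Category.assoc, Category.assoc, Dπ_map, Category.assoc, coverΔ_ι, ← Category.assoc
      (V.KVmap _ _ _), KVmap_ι, Category.assoc, ← Category.assoc (V.V.map _),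
      ← Category.assoc (V.V.map (c.map φ.a)), ← V.V.map_comp, ← V.V.map_comp]
    congr 1
    -- The chosen lifts of morphisms need not compose strictly. The two composites agree over `T.B`,
    -- which suffices after passing to `DV`.
    refine V.map_comp_DVπ (p := c.π T.B) ?_
    rw [Category.assoc, c.comm, Category.assoc, c.comm, ← Category.assoc, c.comm,
      ← Category.assoc (c.map φ.a), c.comm, Category.assoc, Category.assoc, φ.comm_f]
  have h₂ : V.KVmap (c.map φ.a) φ.b w ≫ V.KVtoK c T = V.KVtoK c S ≫ φ.κ := by
    rw [← cancel_mono T.k, Category.assoc, KVtoK_k, ← Category.assoc, KVmap_ι, Category.assoc,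
      ← Category.assoc (V.V.map _), incl_naturality, Category.assoc, c.comm, Category.assoc,
      ← φ.comm_k, ← Category.assoc (V.KVtoK c S), KVtoK_k, Category.assoc, Category.assoc]
  rw [← cancel_epi (V.coverΔ c S), ← Category.assoc, h₁, Category.assoc, coverΔ_connecting,
    ← Category.assoc, h₂, Category.assoc, quotV₁π_naturality, ← Category.assoc,
    ← coverΔ_connecting, Category.assoc]

/-- An element of `K` killed in `U(A)` lies in `V(A)` and lifts locally along `V(p)` to `V(A₀)`. The
lift is killed by `p ≫ f`, so it represents an element of `ΔV(B)`. -/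
lemma exactAt_quotV₁ (S : SES C) : ExactAt (V.connecting c S) (V.quotV₁toU S) := by
  refine exactAt_of_cover ?_ fun {T} x hx => ?_
  · refine IsZeroHom.of_regularEpi_comp (V.isRegularEpi_coverΔ c S) ?_
    rw [← Category.assoc, coverΔ_connecting, Category.assoc, quotV₁π_toU, ← Category.assoc,
      KVtoK_k, ← incl_naturality, Category.assoc, Category.assoc]
    exact ((V.isKer_incl _).zero.comp_left _).comp_left _
  · have hk := S.shortExact.1.mono
    obtain ⟨T₁, c₁, y, hc₁, hy⟩ := exists_cover (V.isCoker_quotV₁π S).isRegularEpi x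
    obtain ⟨a, ha⟩ := (V.isKer_incl S.A).exists_lift (y ≫ S.k) (by
      rw [Category.assoc, ← quotV₁π_toU, ← Category.assoc, hy, Category.assoc]
      exact hx.comp_left c₁)
    obtain ⟨T₂, c₂, z, hc₂, hz⟩ := exists_cover (V.map_regularEpi _ (c.regularEpi S.A)) a
    have hzp : z ≫ V.incl _ ≫ c.π S.A = c₂ ≫ y ≫ S.k := by
      rw [← incl_naturality, ← Category.assoc, hz, Category.assoc, ha]
    have hz₀ : IsZeroHom (z ≫ V.incl _ ≫ c.π S.A ≫ S.f) := by
      have : z ≫ V.incl _ ≫ c.π S.A ≫ S.f = (c₂ ≫ y) ≫ S.k ≫ S.f := by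
        rw [← Category.assoc (V.incl _), ← Category.assoc z, hzp]
        simp only [Category.assoc]
      rw [this]
      exact S.shortExact.1.zero.comp_left _
    refine ⟨T₂, c₂ ≫ c₁, V.KVlift _ z hz₀ ≫ V.coverΔ c S, isRegularEpi_comp hc₂ hc₁, ?_⟩
    have h : V.KVlift _ z hz₀ ≫ V.KVtoK c S = c₂ ≫ y := by
      rw [← cancel_mono S.k, Category.assoc, KVtoK_k, ← Category.assoc, KVlift_ι, hzp,
        Category.assoc]
    rw [Category.assoc, coverΔ_connecting, ← Category.assoc, h, Category.assoc, hy,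
      Category.assoc]

lemma KVincl_coverΔ (S : SES C) :
    V.KVincl c S ≫ V.coverΔ c S = V.Δπ c S.A ≫ V.Δmap c S.f := by
  rw [← cancel_mono (V.Δι c S.B), Category.assoc, coverΔ_ι, ← Category.assoc, KVincl_ι,
    Category.assoc, Δmap_ι, ← Category.assoc (V.Δπ c S.A), Δπ_ι, Category.assoc, Dπ_map]

/-- An element killed by the connecting arrow is represented locally in `K[pf] ∩ V(A₀)` with image
in `V₁f`. Correcting by `V₁(pf)`, which covers `V₁f` and vanishes in `ΔV(B)`, moves it into `K[p] ∩
V(A₀)`, where `coverΔ` is `ΔVf` by `KVincl_coverΔ`. -/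
lemma exactAt_Δ (S : SES C) : ExactAt (V.Δmap c S.f) (V.connecting c S) := by
  refine exactAt_of_cover ?_ fun {T} x hx => ?_
  · refine IsZeroHom.of_regularEpi_comp (V.isRegularEpi_Δπ c S.A) ?_
    rw [← Category.assoc, ← KVincl_coverΔ, Category.assoc, coverΔ_connecting, ← Category.assoc]
    exact (V.isKer_KVincl c S).zero.comp_right _
  · obtain ⟨T₁, c₁, y, hc₁, hy⟩ := exists_cover (V.isRegularEpi_coverΔ c S) x
    obtain ⟨a, ha⟩ := (V.isKer_quotV₁π S).exists_lift (y ≫ V.KVtoK c S) (by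
      rw [Category.assoc, ← coverΔ_connecting, ← Category.assoc, hy, Category.assoc]
      exact hx.comp_left c₁)
    -- The preimage of `V₁f` under `KVtoK`. Its projection `g` to `V₁f` has kernel `K[p] ∩ V(A₀)`,
    -- and `V₁(pf)` maps to it by `j`.
    let n := pullback.fst (V.KVtoK c S) (V.V₁toK S)
    let g := pullback.snd (V.KVtoK c S) (V.V₁toK S)
    have hng : n ≫ V.KVtoK c S = g ≫ V.V₁toK S := pullback.condition
    obtain ⟨t, ht⟩ := (V.isKer_KVincl c S).zero
    let k : V.KV (c.π S.A) ⟶ pullback (V.KVtoK c S) (V.V₁toK S) :=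
      pullback.lift (V.KVincl c S) (t ≫ initial.to _) (by rw [ht]; simp)
    have hkn : k ≫ n = V.KVincl c S := pullback.lift_fst _ _ _
    have hkg : k ≫ g = t ≫ initial.to _ := pullback.lift_snd _ _ _
    have hk : IsKer k g := by
      have hm₁ := (V.isKer_KVincl c S).mono
      have hm₂ := (V.isKer_quotV₁π S).mono
      have : Mono (k ≫ n) := by rwa [hkn]
      have : Mono k := mono_of_mono k n
      have : Mono n := inferInstanceAs (Mono (pullback.fst _ _))
      refine IsKer.mk' ⟨t, hkg⟩ fun z hz => ?_
      obtain ⟨w, hw⟩ := (V.isKer_KVincl c S).exists_lift (z ≫ n) (by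
        rw [Category.assoc, hng, ← Category.assoc]
        exact hz.comp_right _)
      exact ⟨w, by rw [← cancel_mono n, Category.assoc, hkn, hw]⟩
    let j : V.V₁ (c.π S.A ≫ S.f) ⟶ pullback (V.KVtoK c S) (V.V₁toK S) :=
      pullback.lift (V.V₁toKV _) (V.V₁map (c.π S.A) (𝟙 S.B) (by simp)) (V.V₁toKV_KVtoK c S)
    have hjn : j ≫ n = V.V₁toKV _ := pullback.lift_fst _ _ _
    have hjg : j ≫ g = V.V₁map (c.π S.A) (𝟙 S.B) (by simp) := pullback.lift_snd _ _ _
    obtain ⟨T₂, c₂, z, hc₂, hz⟩ := exists_cover_ker hk (n ≫ V.coverΔ c S) j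
      (by rw [hjg]; exact V.isRegularEpi_V₁map (c.regularEpi S.A) S.f _)
      (by rw [← Category.assoc, hjn]; exact (V.isKer_coverΔ c S).zero)
      (pullback.lift y a ha.symm)
    have hn : pullback.lift y a ha.symm ≫ n = y := pullback.lift_fst _ _ _
    refine ⟨T₂, c₂ ≫ c₁, z ≫ V.Δπ c S.A, isRegularEpi_comp hc₂ hc₁, ?_⟩
    rw [Category.assoc, ← KVincl_coverΔ, ← hkn, Category.assoc, hz,
      ← Category.assoc (pullback.lift y a _), hn, hy, Category.assoc]

end BirkhoffSubfunctor

/-- A monomorphism out of an object that maps to `0` gives a sequence that is exact at that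
object. -/
lemma exactAt_initial_of_mono [QuasiPointed C] {X Y : C} (f : X ⟶ Y) [Mono f] :
    ExactAt (initial.to X) f := by
  have := mono_initial_to X
  refine ⟨⊥_ C, 𝟙 _, initial.to X, inferInstance, by simp, IsKer.mk' ⟨𝟙 _, ?_⟩ ?_⟩
  · simp
  · rintro T x ⟨t, ht⟩
    exact ⟨t, by rw [← cancel_mono f, ht]; simp⟩

end

end Baer

/-! ### Assembly of the exact sequence -/

open Baer
theorem mainTheorem3 {C : Type u} [Category.{v} C] [BarrExact C] [Sequentiable C]
    [EnoughRegularProjectives C] (V : BirkhoffSubfunctor C) (c : ProjectiveChoice C) :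
    ∃ (Q : SES C ⥤ C) (q : SES.left C ⟶ Q)
      (σ : V.Kγ c ⟶ SES.middle C ⋙ V.Δ c) (δ : SES.right C ⋙ V.Δ c ⟶ Q)
      (ε : Q ⟶ SES.middle C ⋙ V.U),
      (∀ S : SES C, IsShortExact (V.V₁toK S) (q.app S)) ∧
      (∀ S : SES C, σ.app S ≫ V.Δι c S.A = ker (V.γ c S) ≫ ker ((V.D c).map S.f)) ∧
      (∀ S : SES C, q.app S ≫ ε.app S = S.k ≫ V.η S.A) ∧
      ∀ S : SES C,
        ExactAt (initial.to ((V.Kγ c).obj S)) (σ.app S) ∧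
        ExactAt (σ.app S) ((V.Δ c).map S.f) ∧
        ExactAt ((V.Δ c).map S.f) (δ.app S) ∧
        ExactAt (δ.app S) (ε.app S) ∧
        ExactAt (ε.app S) (V.U.map S.f) ∧
        IsRegularEpi (V.U.map S.f) := by
  refine ⟨V.quotV₁,
    { app := fun S => V.quotV₁π S, naturality := fun _ _ φ => V.quotV₁π_naturality φ },
    { app := fun S => V.KγtoΔ c S, naturality := fun _ _ φ => V.KγtoΔ_naturality c φ },
    { app := fun S => V.connecting c S, naturality := fun _ _ φ => V.connecting_naturality c φ },
    { app := fun S => V.quotV₁toU S, naturality := fun _ _ φ => V.quotV₁toU_naturality φ },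
    fun S => ⟨V.isKer_quotV₁π S, V.isCoker_quotV₁π S⟩, V.KγtoΔ_ι c, V.quotV₁π_toU, fun S =>
    ⟨exactAt_initial_of_mono (V.KγtoΔ c S),
      -- The arrow out of `K[γ]` is itself a kernel of `ΔVf`, so it is its own image.
      ⟨_, 𝟙 _, V.KγtoΔ c S, inferInstance, Category.id_comp _, V.isKer_KγtoΔ c S⟩,
      V.exactAt_Δ c S, V.exactAt_quotV₁ c S, V.exactAt_U_map S,
      V.isRegularEpi_U_map S.isRegularEpi⟩⟩
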